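/- For a locally Lipschitz function $f:\mathbb R^2\to\mathbb R$ of the variables $(y,t)$ let $\nabla^f=\partial_y+f\,\partial_t$, so that $\nabla^f f=\partial_y f+f\,\partial_t f$ is defined almost everywhere. Call $f$ stationary if $$\frac{d}{d\epsilon}\Big|_{\epsilon=0}\int_{\operatorname{spt}\varphi}\sqrt{1+\big(\nabla^{f+\epsilon\varphi}(f+\epsilon\varphi)\big)^2}\,d\mathcal L^2=0\qquad\text{for all }\varphi\in C_c^\infty(\mathbb R^2).$$ A Lagrangian homeomorphism $\Psi:\mathbb R^2\to\mathbb R^2$ associated with $\nabla^f$ is a continuous bijection of the form $\Psi(s,\tau)=(s,\chi(s,\tau))$ such that $\tau\mapsto\chi(s,\tau)$ is nondecreasing for every $s$ and, for every $\tau$, the curve $s\mapsto\Psi(s,\tau)$ is absolutely continuous on bounded intervals with $\partial_s\Psi(s,\tau)=(1,f(\Psi(s,\tau)))$ for almost every $s$. It is locally biLipschitz if $\Psi$ and $\Psi^{-1}$ are locally Lipschitz. **Corollary.** Suppose that $f:\mathbb R^2\to\mathbb R$ is locally Lipschitz and stationary. Then there is a unique locally biLipschitz Lagrangian homeomorphism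 $\Psi:\mathbb R^2\to\mathbb R^2$, $\Psi(s,\tau)=(s,\chi(s,\tau))$, associated with $\nabla^f$ such that $\chi(0,\tau)=\tau$ for all $\tau\in\mathbb R$. Moreover, $\nabla^f f$ agrees almost everywhere with a (necessarily unique) locally Lipschitz function on $\mathbb R^2$, again denoted $\nabla^f f$, and $$\chi(s,\tau)=a(\tau)\frac{s^2}{2}+b(\tau)\,s+\tau\qquad\text{for all }s,\tau\in\mathbb R,$$ where $a,b:\mathbb R\to\mathbb R$, $a(\tau)=\nabla^f f(0,\tau)$ and $b(\tau)=f(0,\tau)$, are locally Lipschitz. -/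

import Mathlib

open MeasureTheory Set
open scoped ContDiff

noncomputable section

/-- The intrinsic gradient `∇^f f = ∂_y f + f ∂_t f` of a function `f` of `(y, t)`. For locally
Lipschitz `f` the classical partial derivatives exist almost everywhere and are the weak ones, so
this function represents the almost everywhere defined `∇^f f`. -/
def intrinsicGradient (f : ℝ × ℝ → ℝ) (p : ℝ × ℝ) : ℝ :=
  fderiv ℝ f p (1, 0) + f p * fderiv ℝ f p (0, 1)

/-- The graph area functional `𝒜_f(E) = ∫_E √(1 + (∇^f f)²)`. -/
def graphArea (f : ℝ × ℝ → ℝ) (E : Set (ℝ × ℝ)) : ℝ :=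
  ∫ p in E, Real.sqrt (1 + intrinsicGradient f p ^ 2)

/-- `f` is stationary on the plane: for every test function `φ ∈ C_c^∞(ℝ²)`, the function
`ε ↦ 𝒜_{f + ε φ}(spt φ)` has derivative `0` at `ε = 0`. -/
def IsStationaryGraph (f : ℝ × ℝ → ℝ) : Prop :=
  ∀ φ : ℝ × ℝ → ℝ, ContDiff ℝ ∞ φ → HasCompactSupport φ →
    HasDerivAt (fun ε : ℝ => graphArea (fun p => f p + ε * φ p) (tsupport φ)) 0 0

/-- `Ψ : U → V` is a Lagrangian parametrization associated with the vector field
`∇^f = ∂_y + f ∂_t`: a continuous map of the open set `U` onto `V` of the form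
`Ψ (s, τ) = (s, χ (s, τ))`, with `χ (s, ·)` nondecreasing on the sections of `U`, such that
for each `τ` the curve `s ↦ Ψ (s, τ)` is (locally) absolutely continuous and satisfies
`∂_s Ψ = (1, f ∘ Ψ)` almost everywhere, on every interval contained in the section of `U`. -/
structure IsLagrangianParametrization (f : ℝ × ℝ → ℝ) (U V : Set (ℝ × ℝ))
    (Ψ : ℝ × ℝ → ℝ × ℝ) : Prop where
  isOpen_source : IsOpen U
  continuousOn : ContinuousOn Ψ U
  image_eq : Ψ '' U = V
  fst_eq : ∀ p ∈ U, (Ψ p).1 = p.1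
  monotoneOn : ∀ s : ℝ, MonotoneOn (fun τ => (Ψ (s, τ)).2) {τ | (s, τ) ∈ U}
  absolutelyContinuous : ∀ τ s₁ s₂ : ℝ, s₁ ≤ s₂ → Icc s₁ s₂ ⊆ {s | (s, τ) ∈ U} →
    AbsolutelyContinuousOnInterval (fun s => Ψ (s, τ)) s₁ s₂
  integralCurve : ∀ τ s₁ s₂ : ℝ, s₁ ≤ s₂ → Icc s₁ s₂ ⊆ {s | (s, τ) ∈ U} →
    ∀ᵐ s : ℝ, s ∈ Icc s₁ s₂ → HasDerivAt (fun r => Ψ (r, τ)) (1, f (Ψ (s, τ))) s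

/-- A Lagrangian homeomorphism is an injective Lagrangian parametrization. -/
structure IsLagrangianHomeomorphism (f : ℝ × ℝ → ℝ) (U V : Set (ℝ × ℝ))
    (Ψ : ℝ × ℝ → ℝ × ℝ) : Prop extends IsLagrangianParametrization f U V Ψ where
  injOn : InjOn Ψ U

/-- A bijection `Ψ : U → V` is a locally biLipschitz homeomorphism if it and its inverse are
locally Lipschitz. -/
def IsLocallyBiLipschitz (U V : Set (ℝ × ℝ)) (Ψ : ℝ × ℝ → ℝ × ℝ) : Prop :=
  BijOn Ψ U V ∧ LocallyLipschitzOn U Ψ ∧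
    ∃ Φ : ℝ × ℝ → ℝ × ℝ, InvOn Φ Ψ U V ∧ LocallyLipschitzOn V Φ

end

/-! Stationarity says weakly that `tilt (∇^f f)`, with `tilt x = x / √(1 + x²)`, is constant along
the integral curves of `∂_y + f ∂_t`. As `tilt` is injective, `∇^f f` should be constant along each
curve, so that `f` is affine in `y` along it and the curve is a parabola. The map `Ψ` then follows
the parabola through `(0, τ)`.

The difficulty is that `∇^f f` is only bounded and measurable while single curves are null sets.
`defect_eq_zero_of_mem_strip` therefore tests the equation on a thin strip of flow lines. Let `m` be
the mean acceleration of a flow line between the two ends of the strip and `W` the deviation of `f`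
from its affine interpolation along that line; then `W` vanishes at both ends and `∇^f W = ∇^f f -
m`. Since `tilt m` is Lipschitz and constant along flow lines, `tilt (∇^f f) - tilt m` annihilates
`div (φ (1, f))` for every `φ` supported in the strip. Tested against `W` times a cutoff, it yields
the nonnegative product `(tilt (∇^f f) - tilt m) (∇^f f - m)`, which must vanish. A second test,
with a multiple of `W²`, gives `W = 0`.

The weak equation involves `div (φ (1, f)) = ∇^f φ + φ ∂_t f` instead of `∇^f φ`. The inverse
Jacobian of the flow would remove the extra term, but it is not regular enough to be a test factor;
`ae_mul_fderiv_eq_zero` uses the quotient `δ / gap` over two flow lines whose labels differ by `δ`,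
and lets `δ → 0`.

Conversely, let all characteristics be parabolas. Uniqueness for the ODE makes them global and
pairwise disjoint. Disjointness orders their accelerations (`monotone_snd`), and comparing two of
them after a short time turns the Lipschitz bound on `f` into one on the acceleration
(`IsAcceleration.locallyLipschitz`). -/

/-! ### Gronwall estimates and uniqueness for scalar ODEs -/

/-- `w² e^{-2Ks}` is nonincreasing and `w² e^{2Ks}` is nondecreasing; squaring avoids
differentiating `|w|`. The bound works in both time directions, so it gives uniqueness as well as
Lipschitz bounds for a flow and its inverse. -/
theorem abs_le_exp_mul_of_abs_deriv_le {a b K : ℝ} {w w' : ℝ → ℝ}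
    (hw : ContinuousOn w (Icc a b)) (hd : ∀ s ∈ Ioo a b, HasDerivAt w (w' s) s)
    (hb : ∀ s ∈ Ioo a b, |w' s| ≤ K * |w s|) {r s : ℝ} (hr : r ∈ Icc a b) (hs : s ∈ Icc a b) :
    |w s| ≤ Real.exp (K * |s - r|) * |w r| := by
  have key : ∀ s ∈ Ioo a b, |w s * w' s| ≤ K * (w s) ^ 2 := fun s hs => by
    rw [abs_mul, ← sq_abs (w s)]
    nlinarith [hb s hs, abs_nonneg (w s)]
  have hE : ∀ (c s : ℝ), HasDerivAt (fun x => Real.exp (c * x)) (Real.exp (c * s) * c) s :=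
    fun c s => by simpa using ((hasDerivAt_id s).const_mul c).exp
  have hder : ∀ c : ℝ, ∀ s ∈ Ioo a b, HasDerivAt (fun x => w x ^ 2 * Real.exp (c * x))
      ((2 * (w s * w' s) + c * w s ^ 2) * Real.exp (c * s)) s := fun c s hs => by
    refine (((hd s hs).pow 2).mul (hE c s)).congr_deriv ?_
    simp only [Pi.pow_apply]; push_cast; ring
  have hcont : ∀ c : ℝ, ContinuousOn (fun x => w x ^ 2 * Real.exp (c * x)) (Icc a b) :=
    fun c => (hw.pow 2).mul (by fun_prop)
  have fin : ∀ x : ℝ, w s ^ 2 * Real.exp (-(2 * x) ) ≤ w r ^ 2 →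
      |w s| ≤ Real.exp x * |w r| := fun x hx => by
    apply abs_le_of_sq_le_sq' _ (by positivity) |>.2
    rw [mul_pow, sq_abs, sq_abs, ← Real.exp_nat_mul]
    have : w s ^ 2 = w s ^ 2 * Real.exp (-(2 * x)) * Real.exp (2 * x) := by
      rw [mul_assoc, ← Real.exp_add]; simp
    rw [this]
    push_cast
    nlinarith [Real.exp_pos (2 * x)]
  rcases le_total r s with h | h
  · rw [abs_of_nonneg (sub_nonneg.2 h)]
    have anti : AntitoneOn (fun x => w x ^ 2 * Real.exp (-(2 * K) * x)) (Icc a b) := by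
      apply antitoneOn_of_deriv_nonpos (convex_Icc a b) (hcont _)
      · rw [interior_Icc]
        exact fun x hx => (hder _ x hx).differentiableAt.differentiableWithinAt
      · rw [interior_Icc]
        intro x hx
        rw [(hder _ x hx).deriv]
        nlinarith [Real.exp_pos (-(2 * K) * x), (abs_le.1 (key x hx)).2]
    have := anti hr hs h
    simp only at this
    apply fin
    have e : Real.exp (-(2 * (K * (s - r)))) = Real.exp (-(2 * K) * s) * Real.exp (2 * K * r) := by
      rw [← Real.exp_add]; ring_nf
    have e' : w r ^ 2 = w r ^ 2 * Real.exp (-(2 * K) * r) * Real.exp (2 * K * r) := by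
      rw [mul_assoc, ← Real.exp_add]; simp
    rw [e, e', ← mul_assoc]
    gcongr
  · rw [abs_of_nonpos (sub_nonpos.2 h)]
    have mono : MonotoneOn (fun x => w x ^ 2 * Real.exp ((2 * K) * x)) (Icc a b) := by
      apply monotoneOn_of_deriv_nonneg (convex_Icc a b) (hcont _)
      · rw [interior_Icc]
        exact fun x hx => (hder _ x hx).differentiableAt.differentiableWithinAt
      · rw [interior_Icc]
        intro x hx
        rw [(hder _ x hx).deriv]
        nlinarith [Real.exp_pos ((2 * K) * x), (abs_le.1 (key x hx)).1]
    have := mono hs hr h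
    simp only at this
    apply fin
    have e : Real.exp (-(2 * (K * (-(s - r))))) = Real.exp ((2 * K) * s) * Real.exp (-(2 * K * r)) := by
      rw [← Real.exp_add]; ring_nf
    have e' : w r ^ 2 = w r ^ 2 * Real.exp ((2 * K) * r) * Real.exp (-(2 * K * r)) := by
      rw [mul_assoc, ← Real.exp_add]; simp
    rw [e, e', ← mul_assoc]
    gcongr

/-- A zero of `w` between `s` and `r` would propagate to `r` by the exponential bound. Applied to a
difference of solutions, this preserves their order. -/
theorem pos_of_abs_deriv_le {a b K : ℝ} {w w' : ℝ → ℝ}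
    (hw : ContinuousOn w (Icc a b)) (hd : ∀ s ∈ Ioo a b, HasDerivAt w (w' s) s)
    (hb : ∀ s ∈ Ioo a b, |w' s| ≤ K * |w s|) {r s : ℝ} (hr : r ∈ Icc a b) (hs : s ∈ Icc a b)
    (h : 0 < w r) : 0 < w s := by
  by_contra hneg
  have hsub : uIcc s r ⊆ Icc a b := uIcc_subset_Icc hs hr
  obtain ⟨z, hz, hz0⟩ := intermediate_value_uIcc (hw.mono hsub)
    (show (0 : ℝ) ∈ uIcc (w s) (w r) from mem_uIcc.2 (Or.inl ⟨not_lt.1 hneg, h.le⟩))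
  have := abs_le_exp_mul_of_abs_deriv_le hw hd hb (hsub hz) hr
  rw [hz0] at this
  simp at this
  exact h.ne' this

theorem LocallyLipschitz.exists_lipschitzOnWith_isCompact {X : Type*} [PseudoMetricSpace X]
    {f : X → ℝ} (hf : LocallyLipschitz f) {S : Set X} (hS : IsCompact S) :
    ∃ K : NNReal, LipschitzOnWith K f S :=
  LocallyLipschitzOn.exists_lipschitzOnWith_of_compact hS (hf.locallyLipschitzOn)

theorem LipschitzOnWith.abs_sub_le_snd {f : ℝ × ℝ → ℝ} {K : NNReal} {S : Set (ℝ × ℝ)}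
    (h : LipschitzOnWith K f S) {s x y : ℝ} (hx : (s, x) ∈ S) (hy : (s, y) ∈ S) :
    |f (s, x) - f (s, y)| ≤ K * |x - y| := by
  have := h.dist_le_mul _ hx _ hy
  simpa [Prod.dist_eq, Real.dist_eq] using this

/-- Uniqueness for `γ' = f (s, γ)` with `f` locally Lipschitz. -/
theorem LocallyLipschitz.eqOn_of_hasDerivAt {f : ℝ × ℝ → ℝ} (hf : LocallyLipschitz f)
    {γ₁ γ₂ : ℝ → ℝ} {a b r : ℝ} (h₁ : ContinuousOn γ₁ (Icc a b)) (h₂ : ContinuousOn γ₂ (Icc a b))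
    (d₁ : ∀ s ∈ Ioo a b, HasDerivAt γ₁ (f (s, γ₁ s)) s)
    (d₂ : ∀ s ∈ Ioo a b, HasDerivAt γ₂ (f (s, γ₂ s)) s)
    (hr : r ∈ Icc a b) (h : γ₁ r = γ₂ r) : EqOn γ₁ γ₂ (Icc a b) := by
  intro s hs
  have c₁ := isCompact_Icc.image_of_continuousOn (continuousOn_id.prodMk h₁)
  have c₂ := isCompact_Icc.image_of_continuousOn (continuousOn_id.prodMk h₂)
  obtain ⟨K, hK⟩ := hf.exists_lipschitzOnWith_isCompact (c₁.union c₂)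
  have := abs_le_exp_mul_of_abs_deriv_le (K := K) (h₁.sub h₂)
    (fun s hs => (d₁ s hs).sub (d₂ s hs)) (fun s hs => by
      have hs' := Ioo_subset_Icc_self hs
      exact hK.abs_sub_le_snd (Or.inl ⟨s, hs', rfl⟩) (Or.inr ⟨s, hs', rfl⟩)) hr hs
  simpa [h, sub_eq_zero] using this

/-! ### Parabolic characteristics: from local to global -/

/-- The parabola through `p` with slope `b` and acceleration `c`. -/
noncomputable def parabola (p : ℝ × ℝ) (b c s : ℝ) : ℝ := p.2 + b * (s - p.1) + c * ((s - p.1) ^ 2 / 2)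

@[simp] theorem parabola_self (p : ℝ × ℝ) (b c : ℝ) : parabola p b c p.1 = p.2 := by
  simp [parabola]

theorem hasDerivAt_parabola (p : ℝ × ℝ) (b c s : ℝ) :
    HasDerivAt (parabola p b c) (b + c * (s - p.1)) s := by
  have h := (hasDerivAt_id s).sub_const p.1
  refine (((h.const_mul b).const_add p.2).add (((h.pow 2).div_const 2).const_mul c)).congr_deriv ?_
  simp only [id]; push_cast; ring

theorem continuous_parabola (p : ℝ × ℝ) (b c : ℝ) : Continuous (parabola p b c) := by
  unfold parabola; fun_prop

/-- Through each point passes a short arc of parabola along which `f` is its derivative. -/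
def HasParabolicCharacteristics (f : ℝ × ℝ → ℝ) : Prop :=
  ∀ p : ℝ × ℝ, ∃ c : ℝ, ∃ ε > 0, ∀ s : ℝ, |s - p.1| < ε →
    f (s, parabola p (f p) c s) = f p + c * (s - p.1)

namespace HasParabolicCharacteristics

variable {f : ℝ × ℝ → ℝ}

/-- Continuity argument: the set of times up to which the identity holds is closed. At such a time
`x` the local arc through the current point solves the same ODE just before `x`, so it has the same
acceleration and extends the identity beyond `x`. -/
theorem continue_forward (hf : LocallyLipschitz f) (h : HasParabolicCharacteristics f)
    {p : ℝ × ℝ} {c ε : ℝ} (hε : 0 < ε) (hc : ∀ s : ℝ, |s - p.1| < ε →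
      f (s, parabola p (f p) c s) = f p + c * (s - p.1)) {s : ℝ} (hs : p.1 ≤ s) :
    f (s, parabola p (f p) c s) = f p + c * (s - p.1) := by
  set q := parabola p (f p) c with hq
  have hqc : Continuous q := continuous_parabola _ _ _
  -- Starting at `p.1 - ε / 2` rather than `p.1` leaves, even for `x = p.1`, a stretch to the left
  -- of `x` on which accelerations can be compared.
  set T : Set ℝ := {x | ∀ r ∈ Icc (p.1 - ε / 2) x, f (r, q r) = f p + c * (r - p.1)} with hT
  have hclosedeq : IsClosed {r : ℝ | f (r, q r) = f p + c * (r - p.1)} :=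
    isClosed_eq (hf.continuous.comp (by fun_prop)) (by fun_prop)
  have hTclosed : IsClosed T := by
    rw [← isSeqClosed_iff_isClosed]
    intro u x hu hux r hr
    rcases hr.2.eq_or_lt with rfl | hlt
    · by_contra hne
      have hev : ∀ᶠ n in Filter.atTop, u n < r := by
        filter_upwards with n
        by_contra hle
        exact hne (hu n r ⟨hr.1, not_lt.1 hle⟩)
      have hev2 := hux.eventually (lt_mem_nhds (show p.1 - ε / 2 - 1 < r by linarith [hr.1]))
      rcases hr.1.eq_or_lt with heq | hgt
      · apply hne
        apply hc
        rw [← heq, abs_lt]; constructor <;> linarith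
      · apply hne
        refine hclosedeq.mem_of_tendsto hux ?_
        filter_upwards [hux.eventually (lt_mem_nhds hgt)] with n hn
        exact hu n (u n) ⟨hn.le, le_rfl⟩
    · obtain ⟨n, hn⟩ := (hux.eventually (lt_mem_nhds hlt)).exists
      exact hu n r ⟨hr.1, hn.le⟩
  have hsub : Icc p.1 (s + 1) ⊆ T := by
    apply IsClosed.Icc_subset_of_forall_exists_gt (hTclosed.inter isClosed_Icc)
    · intro r hr
      apply hc
      rw [abs_lt]; constructor <;> linarith [hr.1, hr.2]
    · rintro x ⟨hxT, hx⟩ y hy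
      obtain ⟨c', ε', hε', hc'⟩ := h (x, q x)
      set q' := parabola (x, q x) (f (x, q x)) c' with hq'
      set a := max (p.1 - ε / 2) (x - ε' / 2) with ha
      have hax : a < x := max_lt (by linarith [hx.1]) (by linarith)
      have heq : EqOn q q' (Icc a x) := by
        refine hf.eqOn_of_hasDerivAt hqc.continuousOn (continuous_parabola _ _ _).continuousOn
          ?_ ?_ (right_mem_Icc.2 hax.le) (parabola_self (x, q x) _ _).symm
        · intro r hr
          rw [hxT r ⟨(le_max_left _ _).trans hr.1.le, hr.2.le⟩]
          exact hasDerivAt_parabola _ _ _ _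
        · intro r hr
          rw [hc' r]
          · exact hasDerivAt_parabola _ _ _ _
          · have := (le_max_right _ _).trans hr.1.le
            have := hr.2
            simp only [abs_lt]; constructor <;> linarith
      have hfx : f (x, q x) = f p + c * (x - p.1) :=
        hxT x ⟨by linarith [hx.1], le_rfl⟩
      have hcc : c' = c := by
        have e1 := hxT a ⟨le_max_left _ _, hax.le⟩
        have e2 := hc' a (by
          have := le_max_right (p.1 - ε / 2) (x - ε' / 2)
          simp only [abs_lt]; constructor <;> linarith)
        rw [← heq (left_mem_Icc.2 hax.le), e1, hfx] at e2
        have : (c' - c) * (a - x) = 0 := by simp only at e2; linarith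
        rcases mul_eq_zero.1 this with h0 | h0 <;> linarith
      have hqq : ∀ r, q' r = q r := fun r => by
        simp only [hq', hq, parabola] at hfx ⊢
        rw [hfx, hcc]; ring
      refine ⟨min y (x + ε' / 2), ?_, lt_min hy (by linarith), min_le_left _ _⟩
      intro r hr
      rcases le_total r x with hrx | hrx
      · exact hxT r ⟨hr.1, hrx⟩
      · have := hc' r (by
          have := hr.2.trans (min_le_right _ _)
          simp only [abs_lt]; constructor <;> linarith)
        rw [hqq, hfx, hcc] at this
        simp only at this
        rw [this]; ring
  exact hsub ⟨hs, by linarith⟩ s ⟨by linarith, le_rfl⟩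

/-- Reversing `y` reduces backward continuation to forward continuation; slopes change sign,
accelerations do not. -/
theorem reflect (h : HasParabolicCharacteristics f) :
    HasParabolicCharacteristics (fun p => -f (-p.1, p.2)) := by
  intro p
  obtain ⟨c, ε, hε, hc⟩ := h (-p.1, p.2)
  refine ⟨c, ε, hε, fun s hs => ?_⟩
  have := hc (-s) (by simp only; rwa [neg_sub_neg, abs_sub_comm])
  simp only [parabola] at this ⊢
  have e : p.2 + -f (-p.1, p.2) * (s - p.1) + c * ((s - p.1) ^ 2 / 2) =
    p.2 + f (-p.1, p.2) * (-s - -p.1) + c * ((-s - -p.1) ^ 2 / 2) := by ring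
  rw [e, this]; ring

theorem exists_global (hf : LocallyLipschitz f) (h : HasParabolicCharacteristics f) (p : ℝ × ℝ) :
    ∃ c : ℝ, ∀ s : ℝ, f (s, parabola p (f p) c s) = f p + c * (s - p.1) := by
  obtain ⟨c, ε, hε, hc⟩ := h p
  refine ⟨c, fun s => ?_⟩
  rcases le_total p.1 s with hs | hs
  · exact h.continue_forward hf hε hc hs
  · have hf' : LocallyLipschitz (fun p : ℝ × ℝ => -f (-p.1, p.2)) := by
      have h1 : LocallyLipschitz (fun p : ℝ × ℝ => (-p.1, p.2)) :=
        (ContDiff.locallyLipschitz (𝕂 := ℝ) (by fun_prop))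
      have h2 : LocallyLipschitz (fun x : ℝ => -x) :=
        (ContDiff.locallyLipschitz (𝕂 := ℝ) (by fun_prop))
      exact h2.comp (hf.comp h1)
    have key : ∀ r, (p.2 + -f (p.1, p.2) * (r - -p.1) + c * ((r - -p.1) ^ 2 / 2)) =
      p.2 + f (p.1, p.2) * (-r - p.1) + c * ((-r - p.1) ^ 2 / 2) := fun r => by ring
    have := h.reflect.continue_forward hf' (p := (-p.1, p.2)) (c := c) hε (fun r hr => by
      have := hc (-r) (by
        rw [← abs_neg]; convert hr using 2; ring)
      simp only [parabola, neg_neg] at this ⊢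
      rw [key, this]; ring) (s := -s) (by simpa using hs)
    simp only [parabola, neg_neg] at this ⊢
    rw [key, neg_neg] at this
    linarith

end HasParabolicCharacteristics

/-! ### Order and Lipschitz regularity of the acceleration -/

theorem mem_closedBall_prod_real {p q : ℝ × ℝ} {r : ℝ} :
    p ∈ Metric.closedBall q r ↔ |p.1 - q.1| ≤ r ∧ |p.2 - q.2| ≤ r := by
  simp [Metric.mem_closedBall, Prod.dist_eq, Real.dist_eq]

/-- `g p` is the acceleration of a global parabolic characteristic through `p`. -/
def IsAcceleration (f g : ℝ × ℝ → ℝ) : Prop :=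
  ∀ (p : ℝ × ℝ) (s : ℝ), f (s, parabola p (f p) (g p) s) = f p + g p * (s - p.1)

namespace IsAcceleration

variable {f g : ℝ × ℝ → ℝ}

theorem hasDerivAt (hg : IsAcceleration f g) (p : ℝ × ℝ) (s : ℝ) :
    HasDerivAt (parabola p (f p) (g p)) (f (s, parabola p (f p) (g p) s)) s := by
  rw [hg p s]; exact hasDerivAt_parabola _ _ _ _

theorem eq_parabola (hf : LocallyLipschitz f) (hg : IsAcceleration f g) (p : ℝ × ℝ) {γ : ℝ → ℝ}
    (hγ : ∀ s, HasDerivAt γ (f (s, γ s)) s) {r : ℝ} (h : γ r = parabola p (f p) (g p) r) (s : ℝ) :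
    γ s = parabola p (f p) (g p) s := by
  have hc : Continuous γ := continuous_iff_continuousAt.2 fun s => (hγ s).continuousAt
  exact hf.eqOn_of_hasDerivAt (a := min r s) (b := max r s) hc.continuousOn
    (continuous_parabola _ _ _).continuousOn (fun s _ => hγ s) (fun s _ => hg.hasDerivAt p s)
    ⟨min_le_left _ _, le_max_left _ _⟩ h ⟨min_le_right _ _, le_max_right _ _⟩

theorem parabola_eq (hf : LocallyLipschitz f) (hg : IsAcceleration f g) {p q : ℝ × ℝ}
    (h : q.2 = parabola p (f p) (g p) q.1) (s : ℝ) :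
    parabola q (f q) (g q) s = parabola p (f p) (g p) s :=
  hg.eq_parabola hf p (hg.hasDerivAt q) (r := q.1) (by rw [parabola_self, h]) s

theorem eq_of_mem (hf : LocallyLipschitz f) (hg : IsAcceleration f g) {p q : ℝ × ℝ}
    (h : q.2 = parabola p (f p) (g p) q.1) : g q = g p := by
  have e1 := hg q (q.1 + 1)
  have e2 := hg p (q.1 + 1)
  have e3 := hg p q.1
  rw [hg.parabola_eq hf h, e2] at e1
  rw [← h] at e3
  simp only [Prod.mk.eta] at e3
  rw [e3] at e1
  linarith

/-- Two characteristics that changed order would meet, and would then coincide by uniqueness. -/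
theorem parabola_lt (hf : LocallyLipschitz f) (hg : IsAcceleration f g) {s x y : ℝ} (hxy : x < y)
    (r : ℝ) : parabola (s, x) (f (s, x)) (g (s, x)) r < parabola (s, y) (f (s, y)) (g (s, y)) r := by
  by_contra hr
  obtain ⟨z, -, hz⟩ := intermediate_value_uIcc (a := r) (b := s)
    (f := fun r => parabola (s, y) (f (s, y)) (g (s, y)) r
      - parabola (s, x) (f (s, x)) (g (s, x)) r)
    ((continuous_parabola _ _ _).sub (continuous_parabola _ _ _)).continuousOn
    (show (0 : ℝ) ∈ uIcc _ _ from mem_uIcc.2 (Or.inl ⟨by linarith, by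
      have e1 := parabola_self (s, y) (f (s, y)) (g (s, y))
      have e2 := parabola_self (s, x) (f (s, x)) (g (s, x))
      simp only at e1 e2 ⊢
      rw [e1, e2]; linarith⟩))
  have := hg.eq_parabola hf (s, x) (hg.hasDerivAt (s, y)) (r := z) (sub_eq_zero.1 hz) s
  have e1 := parabola_self (s, y) (f (s, y)) (g (s, y))
  have e2 := parabola_self (s, x) (f (s, x)) (g (s, x))
  simp only at e1 e2
  rw [e1, e2] at this
  exact hxy.ne' this

/-- Disjoint parabolas are ordered by acceleration. -/
theorem monotone_snd (hf : LocallyLipschitz f) (hg : IsAcceleration f g) {s x y : ℝ} (hxy : x < y) :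
    g (s, x) ≤ g (s, y) := by
  by_contra hlt
  push Not at hlt
  set c := g (s, x) - g (s, y) with hc
  have hcpos : 0 < c := sub_pos.2 hlt
  -- The difference of the two parabolas is quadratic in time. Averaging its values at `s ± u`
  -- removes the linear term and leaves `(y - x) - c u² / 2`, which is `0` for this `u` although
  -- both values are positive.
  set u := Real.sqrt (2 * (y - x) / c)
  have hu : u ^ 2 = 2 * (y - x) / c := Real.sq_sqrt (div_nonneg (by linarith) hcpos.le)
  have hu' : c * u ^ 2 = 2 * (y - x) := by rw [hu]; field_simp
  have h1 := hg.parabola_lt hf (s := s) hxy (s + u)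
  have h2 := hg.parabola_lt hf (s := s) hxy (s - u)
  simp only [parabola] at h1 h2
  nlinarith

/-- Over time `u > 0` the function `f` changes by `g p * u` along the parabola, whose displacement
is at most `(1 + |f p| + |g p| u / 2) u`. Divide by `u` and let `u → 0`. -/
theorem abs_le_of_lipschitzOnWith (hg : IsAcceleration f g) {K : NNReal} {S : Set (ℝ × ℝ)}
    (hK : LipschitzOnWith K f S) {p : ℝ × ℝ} (hp : S ∈ nhds p) :
    |g p| ≤ K * (1 + |f p|) := by
  have hcurve : Filter.Tendsto (fun u : ℝ => (p.1 + u, parabola p (f p) (g p) (p.1 + u)))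
      (nhdsWithin 0 (Ioi 0)) (nhds p) := by
    apply tendsto_nhdsWithin_of_tendsto_nhds
    have : Continuous (fun u : ℝ => (p.1 + u, parabola p (f p) (g p) (p.1 + u))) :=
      (by fun_prop : Continuous fun u : ℝ => p.1 + u).prodMk
        ((continuous_parabola _ _ _).comp (by fun_prop))
    simpa using this.tendsto 0
  have hlim : Filter.Tendsto (fun u : ℝ => K * (1 + |f p| + |g p| * u / 2))
      (nhdsWithin 0 (Ioi 0)) (nhds (K * (1 + |f p|))) := by
    apply tendsto_nhdsWithin_of_tendsto_nhds
    have : Continuous (fun u : ℝ => K * (1 + |f p| + |g p| * u / 2)) := by fun_prop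
    simpa using this.tendsto 0
  refine ge_of_tendsto hlim ?_
  filter_upwards [hcurve hp, self_mem_nhdsWithin] with u hu hu0
  rw [mem_Ioi] at hu0
  have h1 := hK.dist_le_mul _ hu _ (mem_of_mem_nhds hp)
  rw [hg p, Real.dist_eq, Prod.dist_eq, Real.dist_eq, Real.dist_eq] at h1
  have e1 : f p + g p * (p.1 + u - p.1) - f p = g p * u := by ring
  have e2 : p.1 + u - p.1 = u := by ring
  have e3 : parabola p (f p) (g p) (p.1 + u) - p.2 = (f p + g p * u / 2) * u := by
    simp only [parabola]; ring
  rw [e1] at h1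
  simp only [e2, e3, abs_mul, abs_of_pos hu0] at h1
  have h2 : max u (|f p + g p * u / 2| * u) ≤ (1 + |f p| + |g p| * u / 2) * u := by
    have h3 : |f p + g p * u / 2| ≤ |f p| + |g p| * u / 2 := by
      refine (abs_add_le _ _).trans (le_of_eq ?_)
      rw [abs_div, abs_mul, abs_of_pos hu0]; norm_num
    have := mul_nonneg (abs_nonneg (g p)) hu0.le
    apply max_le
    · nlinarith [abs_nonneg (f p)]
    · nlinarith
  have h3 : |g p| * u ≤ K * (1 + |f p| + |g p| * u / 2) * u := by
    rw [mul_assoc]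
    exact h1.trans (mul_le_mul_of_nonneg_left h2 K.2)
  exact le_of_mul_le_mul_right h3 hu0

/-- On vertical lines, disjoint parabolas are compared after a short time `h`; in the remaining
direction `g` is constant along parabolas. -/
theorem locallyLipschitz (hf : LocallyLipschitz f) (hg : IsAcceleration f g) :
    LocallyLipschitz g := by
  intro p₀
  obtain ⟨K, hK⟩ := hf.exists_lipschitzOnWith_isCompact (isCompact_closedBall p₀ 1)
  obtain ⟨B₀, hB₀⟩ := (isCompact_closedBall p₀ 1).exists_bound_of_continuousOn
    hf.continuous.continuousOn
  simp only [Real.norm_eq_abs] at hB₀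
  have hB₀0 : 0 ≤ B₀ := (abs_nonneg _).trans (hB₀ p₀ (Metric.mem_closedBall_self (by norm_num)))
  set B := (K : ℝ) * (1 + B₀) with hBdef
  have hK0 : (0 : ℝ) ≤ K := K.2
  have hB0 : 0 ≤ B := by positivity
  have hhalf : Metric.closedBall p₀ (1 / 2) ⊆ Metric.closedBall p₀ 1 :=
    Metric.closedBall_subset_closedBall (by norm_num)
  have hB : ∀ p ∈ Metric.closedBall p₀ (1 / 2), |g p| ≤ B := fun p hp => by
    refine (hg.abs_le_of_lipschitzOnWith hK (p := p) ?_).trans ?_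
    · refine Filter.mem_of_superset (Metric.ball_mem_nhds p (by norm_num : (0 : ℝ) < 1 / 2)) ?_
      intro q hq
      rw [Metric.mem_ball] at hq
      rw [Metric.mem_closedBall] at hp ⊢
      linarith [dist_triangle q p p₀]
    · exact mul_le_mul_of_nonneg_left (by linarith [hB₀ p (hhalf hp)]) hK0
  have hpar : ∀ p ∈ Metric.closedBall p₀ (1 / 2), ∀ s, |s - p.1| ≤ 1 →
      |parabola p (f p) (g p) s - p.2| ≤ (B₀ + B) * |s - p.1| := fun p hp s hs => by
    have e : parabola p (f p) (g p) s - p.2 = (f p + g p * (s - p.1) / 2) * (s - p.1) := by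
      simp only [parabola]; ring
    rw [e, abs_mul]
    refine mul_le_mul_of_nonneg_right ((abs_add_le _ _).trans ?_) (abs_nonneg _)
    rw [abs_div, abs_mul, abs_two]
    have := hB₀ p (hhalf hp)
    have := hB p hp
    nlinarith [abs_nonneg (g p), abs_nonneg (s - p.1)]
  -- `(B₀ + B) * h ≤ 1 / 2` keeps parabolas issued from the half ball inside the unit ball up to
  -- time `h`, and `K * h ≤ 1 / 2` lets the term in `Δg` be absorbed in `h6`.
  set h := 1 / (2 * (B₀ + B + K + 1)) with hh
  have hhm : h * (2 * (B₀ + B + K + 1)) = 1 := by rw [hh]; field_simp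
  have hpos : 0 < h := by positivity
  have hh1 : h ≤ 1 / 2 := by
    nlinarith [mul_nonneg hpos.le hB₀0, mul_nonneg hpos.le hB0, mul_nonneg hpos.le hK0]
  have hh2 : (B₀ + B) * h ≤ 1 / 2 := by nlinarith [mul_nonneg hpos.le hK0]
  have hh3 : K * h ≤ 1 / 2 := by nlinarith [mul_nonneg hpos.le hB₀0, mul_nonneg hpos.le hB0]
  have hmem : ∀ p ∈ Metric.closedBall p₀ (1 / 2),
      (p.1 + h, parabola p (f p) (g p) (p.1 + h)) ∈ Metric.closedBall p₀ 1 := fun p hp => by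
    have hp' := mem_closedBall_prod_real.1 hp
    have h1 := hpar p hp (p.1 + h) (by rw [add_sub_cancel_left, abs_of_pos hpos]; linarith)
    rw [add_sub_cancel_left, abs_of_pos hpos] at h1
    rw [mem_closedBall_prod_real]
    simp only [abs_le] at h1 hp' ⊢
    refine ⟨⟨?_, ?_⟩, ?_, ?_⟩ <;> linarith [h1.1, h1.2, hp'.1.1, hp'.1.2, hp'.2.1, hp'.2.2]
  have hT : ∀ s x y : ℝ, (s, x) ∈ Metric.closedBall p₀ (1 / 2) →
      (s, y) ∈ Metric.closedBall p₀ (1 / 2) → x < y →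
      g (s, y) - g (s, x) ≤ 6 * K / h * (y - x) := fun s x y hx hy hxy => by
    have hm := hg.monotone_snd hf (s := s) hxy
    have h1 := hK.abs_sub_le_snd (s := s + h) (hmem (s, y) hy) (hmem (s, x) hx)
    have h2 := hK.abs_sub_le_snd (hhalf hy) (hhalf hx)
    rw [hg, hg, abs_of_pos (sub_pos.2 (hg.parabola_lt hf hxy _))] at h1
    rw [abs_of_pos (sub_pos.2 hxy)] at h2
    simp only [parabola, add_sub_cancel_left] at h1
    have h3 := (abs_le.1 h1).2
    have h4 := abs_le.1 h2
    set Δf := f (s, y) - f (s, x) with hΔf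
    set Δg := g (s, y) - g (s, x) with hΔg
    -- Lipschitz bound on `f` at time `s + h`: the left side is the increment of `f` between the two
    -- parabolas, the right side `K` times their distance.
    have h5 : Δf + Δg * h ≤ K * ((y - x) + Δf * h + Δg * (h ^ 2 / 2)) := by
      have : (K : ℝ) * ((y - x) + Δf * h + Δg * (h ^ 2 / 2)) =
        K * (y + f (s, y) * h + g (s, y) * (h ^ 2 / 2)
          - (x + f (s, x) * h + g (s, x) * (h ^ 2 / 2))) := by rw [hΔf, hΔg]; ring
      rw [this, hΔf, hΔg]; linarith
    have hΔg0 : 0 ≤ Δg := by rw [hΔg]; linarith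
    have h6 : K * (Δg * (h ^ 2 / 2)) ≤ Δg * h / 4 := by
      nlinarith [mul_nonneg hΔg0 hpos.le]
    have hxy0 : 0 ≤ K * (y - x) := mul_nonneg hK0 (by linarith)
    have h7 : K * (Δf * h) ≤ K * (y - x) := by
      nlinarith [mul_nonneg hK0 hpos.le]
    have h8 : Δg * h ≤ 6 * K * (y - x) := by nlinarith
    rw [div_mul_eq_mul_div, le_div_iff₀ hpos]
    exact h8
  have hT' : ∀ s x y : ℝ, (s, x) ∈ Metric.closedBall p₀ (1 / 2) →
      (s, y) ∈ Metric.closedBall p₀ (1 / 2) →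
      |g (s, x) - g (s, y)| ≤ 6 * K / h * |x - y| := fun s x y hx hy => by
    rcases lt_trichotomy x y with hxy | rfl | hxy
    · have hm := hg.monotone_snd hf (s := s) hxy
      rw [abs_sub_comm, abs_of_nonneg (sub_nonneg.2 hm), abs_sub_comm x,
        abs_of_pos (sub_pos.2 hxy)]
      exact hT s x y hx hy hxy
    · simp
    · have hm := hg.monotone_snd hf (s := s) hxy
      rw [abs_of_nonneg (sub_nonneg.2 hm), abs_of_pos (sub_pos.2 hxy)]
      exact hT s y x hy hx hxy
  -- With this radius, sliding a point of the `η`-ball along its parabola to the abscissa of another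
  -- such point stays in the half ball.
  set η := 1 / (8 * (B₀ + B + 1)) with hη
  have hηm : η * (8 * (B₀ + B + 1)) = 1 := by rw [hη]; field_simp
  have hη0 : 0 < η := by positivity
  have hη1 : η + (B₀ + B) * (2 * η) ≤ 1 / 2 := by
    nlinarith [mul_nonneg hη0.le hB₀0, mul_nonneg hη0.le hB0]
  have hη2 : 2 * η ≤ 1 / 2 := by
    nlinarith [mul_nonneg hη0.le hB₀0, mul_nonneg hη0.le hB0]
  have hLnn : 0 ≤ 6 * K / h * (1 + B₀ + B) := by positivity
  refine ⟨⟨6 * K / h * (1 + B₀ + B), hLnn⟩, Metric.closedBall p₀ η,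
    Metric.closedBall_mem_nhds _ hη0, LipschitzOnWith.of_dist_le_mul fun p hp q hq => ?_⟩
  have hsub : Metric.closedBall p₀ η ⊆ Metric.closedBall p₀ (1 / 2) :=
    Metric.closedBall_subset_closedBall (by linarith)
  have hp' := mem_closedBall_prod_real.1 hp
  have hq' := mem_closedBall_prod_real.1 hq
  have hqp : |q.1 - p.1| ≤ 2 * η := by
    have := hp'.1
    have := hq'.1
    simp only [abs_le] at *
    constructor <;> linarith
  -- Slide `p` along its parabola to the vertical line of `q`: `g` keeps its value, and only the
  -- vertical estimate is left.
  set y := parabola p (f p) (g p) q.1 with hy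
  have hyp := hpar p (hsub hp) q.1 (by linarith)
  rw [← hy] at hyp
  have hyp2 : |y - p.2| ≤ (B₀ + B) * (2 * η) :=
    hyp.trans (mul_le_mul_of_nonneg_left hqp (by positivity))
  have hymem : (q.1, y) ∈ Metric.closedBall p₀ (1 / 2) := by
    rw [mem_closedBall_prod_real]
    refine ⟨hq'.1.trans (by linarith), ?_⟩
    have e : y - p₀.2 = (y - p.2) + (p.2 - p₀.2) := by ring
    simp only
    rw [e]
    exact (abs_add_le _ _).trans (by linarith [hp'.2])
  have hgy : g (q.1, y) = g p := hg.eq_of_mem hf rfl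
  have h1 := hT' q.1 y q.2 hymem (hsub hq)
  rw [hgy] at h1
  have hd1 : |q.1 - p.1| ≤ dist p q := by
    rw [Prod.dist_eq, abs_sub_comm]; exact le_max_left _ _
  have hd2 : |p.2 - q.2| ≤ dist p q := by
    rw [Prod.dist_eq]; exact le_max_right _ _
  have h2 : |y - q.2| ≤ (1 + B₀ + B) * dist p q := by
    have e : y - q.2 = (y - p.2) + (p.2 - q.2) := by ring
    rw [e]
    refine (abs_add_le _ _).trans ?_
    nlinarith [mul_le_mul_of_nonneg_left hd1 (by positivity : 0 ≤ B₀ + B)]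
  rw [Real.dist_eq]
  refine h1.trans ?_
  change _ ≤ 6 * K / h * (1 + B₀ + B) * dist p q
  rw [mul_assoc]
  exact mul_le_mul_of_nonneg_left h2 (by positivity)

end IsAcceleration

/-! ### Calculus of locally Lipschitz functions -/

theorem LocallyLipschitz.mul_real {X : Type*} [PseudoEMetricSpace X] {u v : X → ℝ}
    (hu : LocallyLipschitz u) (hv : LocallyLipschitz v) : LocallyLipschitz fun x => u x * v x :=
  (ContDiff.locallyLipschitz (𝕂 := ℝ) (f := fun p : ℝ × ℝ => p.1 * p.2) (by fun_prop)).comp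
    (hu.prodMk hv)

theorem LocallyLipschitz.add_real {X : Type*} [PseudoEMetricSpace X] {u v : X → ℝ}
    (hu : LocallyLipschitz u) (hv : LocallyLipschitz v) : LocallyLipschitz fun x => u x + v x :=
  (ContDiff.locallyLipschitz (𝕂 := ℝ) (f := fun p : ℝ × ℝ => p.1 + p.2) (by fun_prop)).comp
    (hu.prodMk hv)

theorem LocallyLipschitz.sub_real {X : Type*} [PseudoEMetricSpace X] {u v : X → ℝ}
    (hu : LocallyLipschitz u) (hv : LocallyLipschitz v) : LocallyLipschitz fun x => u x - v x :=
  (ContDiff.locallyLipschitz (𝕂 := ℝ) (f := fun p : ℝ × ℝ => p.1 - p.2) (by fun_prop)).comp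
    (hu.prodMk hv)

theorem locallyLipschitz_fst : LocallyLipschitz (fun p : ℝ × ℝ => p.1) :=
  LipschitzWith.prod_fst.locallyLipschitz

theorem locallyLipschitz_snd : LocallyLipschitz (fun p : ℝ × ℝ => p.2) :=
  LipschitzWith.prod_snd.locallyLipschitz

theorem LocallyLipschitz.ae_differentiableAt {u : ℝ × ℝ → ℝ} (hu : LocallyLipschitz u) :
    ∀ᵐ p, DifferentiableAt ℝ u p := by
  have key : ∀ n : ℕ, ∀ᵐ p : ℝ × ℝ, p ∈ Metric.ball (0 : ℝ × ℝ) n → DifferentiableAt ℝ u p := by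
    intro n
    obtain ⟨K, hK⟩ := hu.exists_lipschitzOnWith_isCompact (isCompact_closedBall (0 : ℝ × ℝ) n)
    have := (hK.mono Metric.ball_subset_closedBall).ae_differentiableWithinAt_of_mem
      (μ := (volume : Measure (ℝ × ℝ)))
    filter_upwards [this] with p hp hpm
    exact (hp hpm).differentiableAt (Metric.isOpen_ball.mem_nhds hpm)
  filter_upwards [ae_all_iff.2 key] with p hp
  obtain ⟨n, hn⟩ := exists_nat_gt (dist p 0)
  exact hp n hn

theorem intrinsicGradient_eq (f : ℝ × ℝ → ℝ) (p : ℝ × ℝ) :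
    intrinsicGradient f p = fderiv ℝ f p (1, f p) := by
  have : ((1 : ℝ), f p) = (1, 0) + f p • ((0 : ℝ), (1 : ℝ)) := by simp
  rw [this, map_add, map_smul]; rfl

/-- The derivative of `u` along a curve `(r, γ r)` of slope `v`. -/
theorem DifferentiableAt.hasDerivAt_comp_graph {u : ℝ × ℝ → ℝ} {γ : ℝ → ℝ} {s v : ℝ}
    (hu : DifferentiableAt ℝ u (s, γ s)) (hγ : HasDerivAt γ v s) :
    HasDerivAt (fun r => u (r, γ r)) (fderiv ℝ u (s, γ s) (1, v)) s :=
  hu.hasFDerivAt.comp_hasDerivAt s ((hasDerivAt_id s).prodMk hγ)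

theorem IsAcceleration.eq_intrinsicGradient {f g : ℝ × ℝ → ℝ} (hg : IsAcceleration f g)
    {p : ℝ × ℝ} (hp : DifferentiableAt ℝ f p) : g p = intrinsicGradient f p := by
  have e : (p.1, parabola p (f p) (g p) p.1) = p := by simp
  have h := hg.hasDerivAt p p.1
  rw [e] at h
  have h1 := DifferentiableAt.hasDerivAt_comp_graph (u := f) (s := p.1) (by rwa [e]) h
  rw [e] at h1
  have h2 : HasDerivAt (fun s => f p + g p * (s - p.1)) (g p) p.1 := by
    simpa using (((hasDerivAt_id p.1).sub_const p.1).const_mul (g p)).const_add (f p)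
  rw [intrinsicGradient_eq]
  rw [show (fun r => f (r, parabola p (f p) (g p) r)) = fun s => f p + g p * (s - p.1) from
    funext (hg p)] at h1
  exact h2.unique h1

/-! ### The Lagrangian homeomorphism -/

theorem AbsolutelyContinuousOnInterval.snd {γ : ℝ → ℝ × ℝ} {a b : ℝ}
    (h : AbsolutelyContinuousOnInterval γ a b) :
    AbsolutelyContinuousOnInterval (fun s => (γ s).2) a b := by
  rw [absolutelyContinuousOnInterval_iff] at h ⊢
  intro ε hε
  obtain ⟨δ, hδ, H⟩ := h ε hε
  refine ⟨δ, hδ, fun E hE hlt => lt_of_le_of_lt (Finset.sum_le_sum fun i _ => ?_) (H E hE hlt)⟩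
  exact le_max_right _ _

/-- The characteristics of a Lagrangian parametrization of the plane are classical solutions. -/
theorem IsLagrangianParametrization.hasDerivAt_snd {f : ℝ × ℝ → ℝ} (hf : Continuous f)
    {Ψ : ℝ × ℝ → ℝ × ℝ} (h : IsLagrangianParametrization f univ univ Ψ) (τ s : ℝ) :
    HasDerivAt (fun r => (Ψ (r, τ)).2) (f (s, (Ψ (s, τ)).2)) s := by
  have hΨ : Continuous Ψ := continuousOn_univ.1 h.continuousOn
  set γ : ℝ → ℝ := fun r => (Ψ (r, τ)).2 with hγ
  have hγc : Continuous γ := continuous_snd.comp (hΨ.comp (by fun_prop))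
  have hv : Continuous fun r => f (r, γ r) := hf.comp (by fun_prop)
  have hpt : ∀ r, Ψ (r, τ) = (r, γ r) := fun r => Prod.ext (h.fst_eq _ (mem_univ _)) rfl
  -- Absolute continuity recovers the curve from its a.e. derivative; the integrand is continuous,
  -- so the curve is `C¹`.
  have key : ∀ a b, a ≤ b → ∫ r in a..b, f (r, γ r) = γ b - γ a := fun a b hab => by
    have hac := (h.absolutelyContinuous τ a b hab (by simp)).snd
    rw [← hac.integral_deriv_eq_sub]
    apply intervalIntegral.integral_congr_ae
    filter_upwards [h.integralCurve τ a b hab (by simp)] with r hr hrm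
    rw [uIoc_of_le hab] at hrm
    have hd := ((ContinuousLinearMap.snd ℝ ℝ ℝ).hasFDerivAt (x := Ψ (r, τ))).comp_hasDerivAt r
      (hr (Ioc_subset_Icc_self hrm))
    change HasDerivAt γ (f (Ψ (r, τ))) r at hd
    rw [hd.deriv, hpt]
  have hall : ∀ b, γ b = γ 0 + ∫ r in (0 : ℝ)..b, f (r, γ r) := fun b => by
    rcases le_total 0 b with hb | hb
    · rw [key 0 b hb]; ring
    · rw [intervalIntegral.integral_symm, key b 0 hb]; ring
  have := (hv.integral_hasStrictDerivAt 0 s).hasDerivAt.const_add (γ 0)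
  rw [show γ = fun b => γ 0 + ∫ r in (0 : ℝ)..b, f (r, γ r) from funext hall]
  simpa only [← hall] using this

theorem HasParabolicCharacteristics.exists_lagrangianHomeomorphism {f : ℝ × ℝ → ℝ}
    (hf : LocallyLipschitz f) (h : HasParabolicCharacteristics f) :
    ∃ Ψ : ℝ × ℝ → ℝ × ℝ,
      (IsLagrangianHomeomorphism f Set.univ Set.univ Ψ ∧
        IsLocallyBiLipschitz Set.univ Set.univ Ψ ∧ ∀ τ : ℝ, (Ψ (0, τ)).2 = τ) ∧
      (∀ Ψ' : ℝ × ℝ → ℝ × ℝ,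
        (IsLagrangianHomeomorphism f Set.univ Set.univ Ψ' ∧
          IsLocallyBiLipschitz Set.univ Set.univ Ψ' ∧ ∀ τ : ℝ, (Ψ' (0, τ)).2 = τ) →
        Ψ' = Ψ) ∧
      ∃ g : ℝ × ℝ → ℝ, LocallyLipschitz g ∧ g =ᵐ[MeasureTheory.volume] intrinsicGradient f ∧
        ∃ a b : ℝ → ℝ, LocallyLipschitz a ∧ LocallyLipschitz b ∧
          (∀ τ : ℝ, a τ = g (0, τ)) ∧ (∀ τ : ℝ, b τ = f (0, τ)) ∧
          ∀ s τ : ℝ, Ψ (s, τ) = (s, a τ * (s ^ 2 / 2) + b τ * s + τ) := by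
  choose g hg using h.exists_global hf
  replace hg : IsAcceleration f g := hg
  have hgL := hg.locallyLipschitz hf
  set P : ℝ × ℝ → ℝ → ℝ := fun p => parabola p (f p) (g p) with hP
  set Ψ : ℝ × ℝ → ℝ × ℝ := fun p => (p.1, P (0, p.2) p.1) with hΨ
  -- The inverse follows the parabola through `p` back to time `0`. Both maps are explicit in `f`
  -- and `g`, hence locally Lipschitz.
  set Φ : ℝ × ℝ → ℝ × ℝ := fun p => (p.1, P p 0) with hΦ
  have hΨΦ : ∀ p, Ψ (Φ p) = p := fun p => by
    have := hg.parabola_eq hf (p := p) (q := (0, P p 0)) rfl p.1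
    simp only [hΨ, hΦ, hP] at this ⊢
    rw [this, parabola_self]
  have hΦΨ : ∀ p, Φ (Ψ p) = p := fun p => by
    have := hg.parabola_eq hf (p := (0, p.2)) (q := (p.1, P (0, p.2) p.1)) rfl 0
    have e := parabola_self (0, p.2) (f (0, p.2)) (g (0, p.2))
    simp only [hΨ, hΦ, hP] at this e ⊢
    rw [this, e]
  have hzero : LocallyLipschitz (fun p : ℝ × ℝ => ((0 : ℝ), p.2)) :=
    (LocallyLipschitz.const 0).prodMk locallyLipschitz_snd
  have hΨL : LocallyLipschitz Ψ := by
    refine locallyLipschitz_fst.prodMk ?_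
    have hq : ContDiff ℝ 1 fun p : ℝ × ℝ => (p.1 - 0) ^ 2 / 2 := by fun_prop
    exact (locallyLipschitz_snd.add_real ((hf.comp hzero).mul_real
      (locallyLipschitz_fst.sub_real (LocallyLipschitz.const 0)))).add_real
      ((hgL.comp hzero).mul_real hq.locallyLipschitz)
  have hΦL : LocallyLipschitz Φ := by
    refine locallyLipschitz_fst.prodMk ?_
    have hq : ContDiff ℝ 1 fun p : ℝ × ℝ => (0 - p.1) ^ 2 / 2 := by fun_prop
    exact (locallyLipschitz_snd.add_real (hf.mul_real
      ((LocallyLipschitz.const 0).sub_real locallyLipschitz_fst))).add_real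
      (hgL.mul_real hq.locallyLipschitz)
  have hinj : InjOn Ψ univ := fun p _ q _ hpq => by rw [← hΦΨ p, hpq, hΦΨ]
  have hsurj : SurjOn Ψ univ univ := fun p _ => ⟨Φ p, mem_univ _, hΨΦ p⟩
  have hinit : ∀ τ, (Ψ (0, τ)).2 = τ := fun τ => parabola_self (0, τ) _ _
  refine ⟨Ψ, ⟨⟨⟨isOpen_univ, hΨL.continuous.continuousOn, ?_, fun p _ => rfl, ?_, ?_, ?_⟩, hinj⟩,
    ⟨⟨mapsTo_univ _ _, hinj, hsurj⟩, hΨL.locallyLipschitzOn,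
      Φ, ⟨fun p _ => hΦΨ p, fun p _ => hΨΦ p⟩, hΦL.locallyLipschitzOn⟩, hinit⟩, ?_, g, hgL, ?_,
      fun τ => g (0, τ), fun τ => f (0, τ), ?_, ?_, fun _ => rfl, fun _ => rfl, ?_⟩
  · rw [image_univ]; exact (surjOn_univ.1 hsurj).range_eq
  · intro s x _ y _ hxy
    rcases hxy.eq_or_lt with rfl | hlt
    · exact le_rfl
    · exact (hg.parabola_lt hf hlt s).le
  · intro τ s₁ s₂ _ _
    have hl : LocallyLipschitz fun s => Ψ (s, τ) := hΨL.comp (LocallyLipschitz.prodMk_right τ)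
    obtain ⟨K, hK⟩ := LocallyLipschitzOn.exists_lipschitzOnWith_of_compact
      (isCompact_uIcc (a := s₁) (b := s₂)) hl.locallyLipschitzOn
    exact hK.absolutelyContinuousOnInterval
  · intro τ s₁ s₂ _ _
    refine Filter.Eventually.of_forall fun s _ => ?_
    exact (hasDerivAt_id s).prodMk (hg.hasDerivAt (0, τ) s)
  · rintro Ψ' ⟨hL, -, h0⟩
    funext p
    refine Prod.ext (hL.fst_eq p (mem_univ _)) ?_
    refine hg.eq_parabola hf (0, p.2) (γ := fun r => (Ψ' (r, p.2)).2) (r := 0)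
      (fun s => hL.toIsLagrangianParametrization.hasDerivAt_snd hf.continuous p.2 s) ?_ p.1
    simp only [h0]
    exact (hinit p.2).symm
  · filter_upwards [hf.ae_differentiableAt] with p hp
    exact hg.eq_intrinsicGradient hp
  · exact hgL.comp (LocallyLipschitz.prodMk_left 0)
  · exact hf.comp (LocallyLipschitz.prodMk_left 0)
  · intro s τ
    simp only [hΨ, hP, parabola, sub_zero]
    congr 1; ring

/-! ### Divergences and integration by parts -/

/-- The divergence of `φ • (1, f)`. -/
noncomputable def graphDivergence (f φ : ℝ × ℝ → ℝ) (p : ℝ × ℝ) : ℝ :=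
  fderiv ℝ φ p (1, f p) + φ p * fderiv ℝ f p (0, 1)

/-- Balls of the sup norm are squares, so clamping each coordinate works. The last clause, that
outside points land on the sphere, is what lets a function supported in the open ball be recovered
by composing with `c`. -/
theorem exists_retraction_closedBall (p : ℝ × ℝ) {r : ℝ} (hr : 0 ≤ r) :
    ∃ c : ℝ × ℝ → ℝ × ℝ, LipschitzWith 1 c ∧ (∀ q, c q ∈ Metric.closedBall p r) ∧
      (∀ q ∈ Metric.closedBall p r, c q = q) ∧ ∀ q ∉ Metric.closedBall p r, dist (c q) p = r := by
  have h1 : LipschitzWith 1 (fun q : ℝ × ℝ => max (p.1 - r) (min (p.1 + r) q.1)) :=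
    (LipschitzWith.prod_fst.const_min _).const_max _
  have h2 : LipschitzWith 1 (fun q : ℝ × ℝ => max (p.2 - r) (min (p.2 + r) q.2)) :=
    (LipschitzWith.prod_snd.const_min _).const_max _
  have hmem : ∀ x y : ℝ, |max (x - r) (min (x + r) y) - x| ≤ r := fun x y => by
    rw [abs_le]
    constructor
    · linarith [le_max_left (x - r) (min (x + r) y)]
    · have : max (x - r) (min (x + r) y) ≤ x + r := max_le (by linarith) (min_le_left _ _)
      linarith
  have hout : ∀ x y : ℝ, r < |y - x| → |max (x - r) (min (x + r) y) - x| = r := fun x y h => by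
    rcases lt_abs.1 h with h | h
    · rw [min_eq_left (by linarith), max_eq_right (by linarith), add_sub_cancel_left,
        abs_of_nonneg hr]
    · rw [min_eq_right (by linarith), max_eq_left (by linarith)]
      rw [abs_of_nonpos] <;> linarith
  refine ⟨_, by simpa using h1.prodMk h2, ?_, ?_, ?_⟩
  · exact fun q => mem_closedBall_prod_real.2 ⟨hmem _ _, hmem _ _⟩
  · intro q hq
    have := mem_closedBall_prod_real.1 hq
    simp only [abs_le] at this
    obtain ⟨⟨_, _⟩, _, _⟩ := this
    refine Prod.ext ?_ ?_ <;> simp only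
    · rw [min_eq_right (by linarith), max_eq_right (by linarith)]
    · rw [min_eq_right (by linarith), max_eq_right (by linarith)]
  · intro q hq
    rw [mem_closedBall_prod_real, not_and_or, not_le, not_le] at hq
    rw [Prod.dist_eq, Real.dist_eq, Real.dist_eq]
    rcases hq with h | h
    · rw [hout _ _ h]; exact max_eq_left (hmem _ _)
    · rw [hout p.2 _ h]; exact max_eq_right (hmem _ _)

theorem LocallyLipschitz.exists_lipschitzWith_eqOn_closedBall {f : ℝ × ℝ → ℝ}
    (hf : LocallyLipschitz f) (p : ℝ × ℝ) {r : ℝ} (hr : 0 ≤ r) :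
    ∃ (F : ℝ × ℝ → ℝ) (K : NNReal) (M : ℝ), LipschitzWith K F ∧ (∀ q, |F q| ≤ M) ∧
      EqOn F f (Metric.closedBall p r) := by
  obtain ⟨c, hc, hmem, heq, -⟩ := exists_retraction_closedBall p hr
  obtain ⟨K, hK⟩ := hf.exists_lipschitzOnWith_isCompact (isCompact_closedBall p r)
  obtain ⟨M, hM⟩ := (isCompact_closedBall p r).exists_bound_of_continuousOn
    hf.continuous.continuousOn
  refine ⟨f ∘ c, K, M, ?_, fun q => hM _ (hmem q), fun q hq => by simp [heq q hq]⟩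
  have := hK.comp (lipschitzOnWith_univ.2 hc) (fun q _ => hmem q)
  simpa using this

theorem HasCompactSupport.exists_tsupport_subset_ball {φ : ℝ × ℝ → ℝ} (h : HasCompactSupport φ) :
    ∃ R > 0, tsupport φ ⊆ Metric.ball (0 : ℝ × ℝ) R := by
  obtain ⟨R, hR⟩ := h.isCompact.isBounded.subset_ball 0
  exact ⟨max R 1, lt_max_of_lt_right one_pos, hR.trans (Metric.ball_subset_ball (le_max_left _ _))⟩

theorem LocallyLipschitz.exists_lipschitzWith_of_hasCompactSupport {φ : ℝ × ℝ → ℝ}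
    (hφ : LocallyLipschitz φ) (h : HasCompactSupport φ) : ∃ K : NNReal, LipschitzWith K φ := by
  obtain ⟨R, hR0, hR⟩ := h.exists_tsupport_subset_ball
  obtain ⟨c, hc, hmem, heq, hout⟩ := exists_retraction_closedBall 0 hR0.le
  obtain ⟨K, hK⟩ := hφ.exists_lipschitzOnWith_isCompact (isCompact_closedBall (0 : ℝ × ℝ) R)
  have hz : ∀ q ∉ Metric.ball (0 : ℝ × ℝ) R, φ q = 0 := fun q hq =>
    image_eq_zero_of_notMem_tsupport fun hq' => hq (hR hq')
  have : φ = φ ∘ c := by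
    funext q
    by_cases hq : q ∈ Metric.closedBall (0 : ℝ × ℝ) R
    · simp [heq q hq]
    · rw [Function.comp_apply, hz q fun h => hq (Metric.ball_subset_closedBall h), hz (c q)]
      rw [Metric.mem_ball, hout q hq]
      exact lt_irrefl _
  refine ⟨K, ?_⟩
  rw [this]
  have := hK.comp (lipschitzOnWith_univ.2 hc) (fun q _ => hmem q)
  simpa using this

theorem LocallyLipschitz.exists_norm_fderiv_le {f : ℝ × ℝ → ℝ} (hf : LocallyLipschitz f)
    {S : Set (ℝ × ℝ)} (hS : IsCompact S) : ∃ B : ℝ, 0 ≤ B ∧ ∀ p ∈ S, ‖fderiv ℝ f p‖ ≤ B := by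
  obtain ⟨R, hR⟩ := hS.isBounded.subset_ball 0
  obtain ⟨K, hK⟩ := hf.exists_lipschitzOnWith_isCompact (isCompact_closedBall (0 : ℝ × ℝ) R)
  exact ⟨K, K.2, fun p hp => norm_fderiv_le_of_lipschitzOn ℝ
    (Filter.mem_of_superset (Metric.isOpen_ball.mem_nhds (hR hp)) Metric.ball_subset_closedBall) hK⟩

theorem measurable_fderiv_graph (u : ℝ × ℝ → ℝ) {f : ℝ × ℝ → ℝ} (hf : Continuous f) :
    Measurable fun p => fderiv ℝ u p (1, f p) := by
  have : (fun p => fderiv ℝ u p (1, f p)) =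
      fun p => fderiv ℝ u p (1, 0) + f p * fderiv ℝ u p (0, 1) := by
    funext p
    have : ((1 : ℝ), f p) = (1, 0) + f p • ((0 : ℝ), (1 : ℝ)) := by simp
    rw [this, map_add, map_smul]; rfl
  rw [this]
  exact (measurable_fderiv_apply_const ℝ u _).add
    (hf.measurable.mul (measurable_fderiv_apply_const ℝ u _))

theorem integrable_of_bounded_of_eq_zero {k : ℝ × ℝ → ℝ} (hk : AEStronglyMeasurable k volume)
    {S : Set (ℝ × ℝ)} (hS : IsCompact S) {C : ℝ} (hC : ∀ p ∈ S, |k p| ≤ C)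
    (h0 : ∀ p ∉ S, k p = 0) : Integrable k := by
  have h1 : IntegrableOn k S := by
    refine Measure.integrableOn_of_bounded (M := C) hS.measure_lt_top.ne hk ?_
    filter_upwards [ae_restrict_mem hS.measurableSet] with p hp
    exact hC p hp
  rwa [integrableOn_iff_integrable_of_support_subset] at h1
  intro p hp
  by_contra hpS
  exact hp (h0 p hpS)

theorem fderiv_eq_zero_of_notMem_tsupport {φ : ℝ × ℝ → ℝ} {p : ℝ × ℝ} (hp : p ∉ tsupport φ) :
    fderiv ℝ φ p = 0 := by
  by_contra h
  exact hp (support_fderiv_subset ℝ h)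

theorem abs_fderiv_graph_le {u f : ℝ × ℝ → ℝ} {p : ℝ × ℝ} {A B : ℝ} (hA : ‖fderiv ℝ u p‖ ≤ A)
    (hB : |f p| ≤ B) : |fderiv ℝ u p (1, f p)| ≤ A * (1 + B) := by
  refine ((fderiv ℝ u p).le_opNorm _).trans ?_
  have : ‖((1 : ℝ), f p)‖ ≤ 1 + B := by
    rw [Prod.norm_def]
    have := abs_nonneg (f p)
    exact max_le (by simp; linarith) (by rw [Real.norm_eq_abs]; linarith)
  exact mul_le_mul hA this (norm_nonneg _) ((norm_nonneg _).trans hA)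

theorem abs_fderiv_snd_le {u : ℝ × ℝ → ℝ} {p : ℝ × ℝ} {A : ℝ} (hA : ‖fderiv ℝ u p‖ ≤ A) :
    |fderiv ℝ u p (0, 1)| ≤ A := by
  refine ((fderiv ℝ u p).le_opNorm _).trans ?_
  simpa [Prod.norm_def] using hA

theorem measurable_graphDivergence {f φ : ℝ × ℝ → ℝ} (hf : Continuous f) (hφ : Continuous φ) :
    Measurable (graphDivergence f φ) :=
  (measurable_fderiv_graph φ hf).add (hφ.measurable.mul (measurable_fderiv_apply_const ℝ f _))

theorem graphDivergence_eq_zero {f φ : ℝ × ℝ → ℝ} {p : ℝ × ℝ} (hp : p ∉ tsupport φ) :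
    graphDivergence f φ p = 0 := by
  simp [graphDivergence, fderiv_eq_zero_of_notMem_tsupport hp,
    image_eq_zero_of_notMem_tsupport hp]

theorem exists_abs_graphDivergence_le {f φ : ℝ × ℝ → ℝ} (hf : LocallyLipschitz f)
    (hφ : LocallyLipschitz φ) {S : Set (ℝ × ℝ)} (hS : IsCompact S) :
    ∃ C, ∀ p ∈ S, |graphDivergence f φ p| ≤ C := by
  obtain ⟨A, -, hA⟩ := hφ.exists_norm_fderiv_le hS
  obtain ⟨B, hB0, hB⟩ := hf.exists_norm_fderiv_le hS
  obtain ⟨M, hM⟩ := hS.exists_bound_of_continuousOn hf.continuous.continuousOn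
  obtain ⟨N, hN⟩ := hS.exists_bound_of_continuousOn hφ.continuous.continuousOn
  refine ⟨A * (1 + M) + N * B, fun p hp => (abs_add_le _ _).trans (add_le_add
    (abs_fderiv_graph_le (hA p hp) (hM p hp)) ?_)⟩
  rw [abs_mul]
  exact mul_le_mul (hN p hp) (abs_fderiv_snd_le (hB p hp)) (abs_nonneg _)
    ((norm_nonneg _).trans (hN p hp))

theorem integrable_mul_graphDivergence {f φ u : ℝ × ℝ → ℝ} (hf : LocallyLipschitz f)
    (hφ : LocallyLipschitz φ) (hc : HasCompactSupport φ) (hu : Measurable u)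
    (hub : ∀ S : Set (ℝ × ℝ), IsCompact S → ∃ C, ∀ p ∈ S, |u p| ≤ C) :
    Integrable fun p => u p * graphDivergence f φ p := by
  obtain ⟨C, hC⟩ := exists_abs_graphDivergence_le hf hφ hc.isCompact
  obtain ⟨C', hC'⟩ := hub _ hc.isCompact
  refine integrable_of_bounded_of_eq_zero (C := C' * C)
    (hu.mul (measurable_graphDivergence hf.continuous hφ.continuous)).aestronglyMeasurable
    hc.isCompact (fun p hp => ?_) (fun p hp => by rw [graphDivergence_eq_zero hp, mul_zero])
  rw [abs_mul]
  exact mul_le_mul (hC' p hp) (hC p hp) (abs_nonneg _) ((abs_nonneg _).trans (hC' p hp))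

/-- Only `ζ` near the support of `ψ` matters, so a globally Lipschitz function agreeing with it
there may replace it. -/
theorem integral_mul_fderiv_eq_neg {ζ ψ : ℝ × ℝ → ℝ} (hζ : LocallyLipschitz ζ)
    (hψ : LocallyLipschitz ψ) (hc : HasCompactSupport ψ) (v : ℝ × ℝ) :
    ∫ p, ζ p * fderiv ℝ ψ p v = -∫ p, ψ p * fderiv ℝ ζ p v := by
  obtain ⟨R, hR0, hR⟩ := hc.exists_tsupport_subset_ball
  obtain ⟨Z, K, M, hZ, -, hZeq⟩ := hζ.exists_lipschitzWith_eqOn_closedBall 0 hR0.le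
  obtain ⟨K', hK'⟩ := hψ.exists_lipschitzWith_of_hasCompactSupport hc
  have key := hZ.integral_lineDeriv_mul_eq (μ := volume) hK' hc v
  have e1 : ∫ p, ζ p * fderiv ℝ ψ p v = -∫ p, lineDeriv ℝ ψ p (-v) * Z p := by
    rw [← integral_neg]
    apply integral_congr_ae
    filter_upwards [hψ.ae_differentiableAt] with p hp
    rw [hp.lineDeriv_eq_fderiv, map_neg]
    by_cases hm : p ∈ tsupport ψ
    · rw [hZeq (Metric.ball_subset_closedBall (hR hm))]; ring
    · simp [fderiv_eq_zero_of_notMem_tsupport hm]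
  have e2 : ∫ p, ψ p * fderiv ℝ ζ p v = ∫ p, lineDeriv ℝ Z p v * ψ p := by
    apply integral_congr_ae
    filter_upwards [hZ.ae_differentiableAt] with p hp
    rw [hp.lineDeriv_eq_fderiv]
    by_cases hm : p ∈ tsupport ψ
    · have : Z =ᶠ[nhds p] ζ := Filter.eventuallyEq_of_mem
        (Metric.isOpen_ball.mem_nhds (hR hm)) (hZeq.mono Metric.ball_subset_closedBall)
      rw [this.fderiv_eq]; ring
    · simp [image_eq_zero_of_notMem_tsupport hm]
  rw [e1, e2, key]

/-- Integration by parts along the vector field `(1, f)`. -/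
theorem integral_mul_graphDivergence {f ζ φ : ℝ × ℝ → ℝ} (hf : LocallyLipschitz f)
    (hζ : LocallyLipschitz ζ) (hφ : LocallyLipschitz φ) (hc : HasCompactSupport φ) :
    ∫ p, ζ p * graphDivergence f φ p = -∫ p, φ p * fderiv ℝ ζ p (1, f p) := by
  have hfφ : LocallyLipschitz fun p => f p * φ p := hf.mul_real hφ
  have hcf : HasCompactSupport fun p => f p * φ p := hc.mul_left
  have hint : ∀ {ζ ψ : ℝ × ℝ → ℝ}, LocallyLipschitz ζ → LocallyLipschitz ψ →
      HasCompactSupport ψ → ∀ v, Integrable fun p => ζ p * fderiv ℝ ψ p v := by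
    intro ζ ψ hζ hψ hc v
    obtain ⟨A, -, hA⟩ := hψ.exists_norm_fderiv_le hc.isCompact
    obtain ⟨B, hB⟩ := hc.isCompact.exists_bound_of_continuousOn hζ.continuous.continuousOn
    refine integrable_of_bounded_of_eq_zero (C := B * (A * ‖v‖)) (hζ.continuous.measurable.mul
      (measurable_fderiv_apply_const ℝ ψ v)).aestronglyMeasurable hc.isCompact (fun p hp => ?_)
      (fun p hp => by simp [fderiv_eq_zero_of_notMem_tsupport hp])
    rw [abs_mul]
    refine mul_le_mul (hB p hp) (((fderiv ℝ ψ p).le_opNorm v).trans ?_) (abs_nonneg _)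
      ((norm_nonneg _).trans (hB p hp))
    exact mul_le_mul_of_nonneg_right (hA p hp) (norm_nonneg _)
  have hint' : ∀ {ζ ψ : ℝ × ℝ → ℝ}, LocallyLipschitz ζ → LocallyLipschitz ψ →
      HasCompactSupport ψ → ∀ v, Integrable fun p => ψ p * fderiv ℝ ζ p v := by
    intro ζ ψ hζ hψ hc v
    obtain ⟨A, -, hA⟩ := hζ.exists_norm_fderiv_le hc.isCompact
    obtain ⟨B, hB⟩ := hc.isCompact.exists_bound_of_continuousOn hψ.continuous.continuousOn
    refine integrable_of_bounded_of_eq_zero (C := B * (A * ‖v‖)) (hψ.continuous.measurable.mul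
      (measurable_fderiv_apply_const ℝ ζ v)).aestronglyMeasurable hc.isCompact (fun p hp => ?_)
      (fun p hp => by simp [image_eq_zero_of_notMem_tsupport hp])
    rw [abs_mul]
    refine mul_le_mul (hB p hp) (((fderiv ℝ ζ p).le_opNorm v).trans ?_) (abs_nonneg _)
      ((norm_nonneg _).trans (hB p hp))
    exact mul_le_mul_of_nonneg_right (hA p hp) (norm_nonneg _)
  have split : ∀ (u : ℝ × ℝ → ℝ) p,
      fderiv ℝ u p (1, f p) = fderiv ℝ u p (1, 0) + f p * fderiv ℝ u p (0, 1) := fun u p => by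
    have : ((1 : ℝ), f p) = (1, 0) + f p • ((0 : ℝ), (1 : ℝ)) := by simp
    rw [this, map_add, map_smul]; rfl
  -- The divergence is `∂_y φ + ∂_t (f φ)`, to which integration by parts applies in each coordinate
  -- direction separately.
  calc ∫ p, ζ p * graphDivergence f φ p
      = ∫ p, (ζ p * fderiv ℝ φ p (1, 0) + ζ p * fderiv ℝ (fun p => f p * φ p) p (0, 1)) := by
        apply integral_congr_ae
        filter_upwards [hf.ae_differentiableAt, hφ.ae_differentiableAt] with p h1 h2
        rw [graphDivergence, split, fderiv_fun_mul h1 h2]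
        simp; ring
    _ = -∫ p, (φ p * fderiv ℝ ζ p (1, 0) + f p * φ p * fderiv ℝ ζ p (0, 1)) := by
        rw [integral_add (hint hζ hφ hc _) (hint hζ hfφ hcf _),
          integral_add (hint' hζ hφ hc _) (hint' hζ hfφ hcf _),
          integral_mul_fderiv_eq_neg hζ hφ hc, integral_mul_fderiv_eq_neg hζ hfφ hcf]
        ring
    _ = -∫ p, φ p * fderiv ℝ ζ p (1, f p) := by
        congr 2; funext p
        rw [split]; ring

/-! ### The first variation -/

/-- The derivative of `x ↦ √(1 + x²)`. -/
noncomputable def tilt (x : ℝ) : ℝ := x / Real.sqrt (1 + x ^ 2)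

theorem contDiff_tilt : ContDiff ℝ 1 tilt := by
  have h : ∀ x : ℝ, 1 + x ^ 2 ≠ 0 := fun x => by positivity
  have h' : ∀ x : ℝ, Real.sqrt (1 + x ^ 2) ≠ 0 := fun x => by positivity
  unfold tilt
  exact contDiff_id.div ((by fun_prop : ContDiff ℝ 1 fun x : ℝ => 1 + x ^ 2).sqrt h) h'

theorem abs_tilt_le_one (x : ℝ) : |tilt x| ≤ 1 := by
  rw [tilt, abs_div, abs_of_nonneg (Real.sqrt_nonneg _)]
  refine div_le_one_of_le₀ (Real.abs_le_sqrt (by linarith)) (Real.sqrt_nonneg _)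

theorem hasDerivAt_sqrt_one_add_sq {q : ℝ → ℝ} {q' ε : ℝ} (hq : HasDerivAt q q' ε) :
    HasDerivAt (fun e => Real.sqrt (1 + q e ^ 2)) (tilt (q ε) * q') ε := by
  have h := ((hq.pow 2).const_add 1).sqrt (by simp only [Pi.pow_apply]; positivity)
  refine h.congr_deriv ?_
  simp only [Pi.pow_apply, tilt]
  push_cast
  field_simp

/-- Strict convexity of `√(1 + x²)`. For `x`, `y` of the same sign the cross-multiplied inequality
follows by squaring. -/
theorem strictMono_tilt : StrictMono tilt := by
  intro x y hxy
  have hx : 0 < Real.sqrt (1 + x ^ 2) := by positivity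
  have hy : 0 < Real.sqrt (1 + y ^ 2) := by positivity
  have hx2 : Real.sqrt (1 + x ^ 2) ^ 2 = 1 + x ^ 2 := Real.sq_sqrt (by positivity)
  have hy2 : Real.sqrt (1 + y ^ 2) ^ 2 = 1 + y ^ 2 := Real.sq_sqrt (by positivity)
  unfold tilt
  rw [div_lt_div_iff₀ hx hy]
  set a := Real.sqrt (1 + x ^ 2)
  set b := Real.sqrt (1 + y ^ 2)
  rcases le_or_gt 0 x with h0 | h0
  · apply lt_of_pow_lt_pow_left₀ 2 (by nlinarith)
    nlinarith
  · rcases le_or_gt 0 y with h1 | h1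
    · nlinarith [mul_pos (neg_pos.2 h0) hy, mul_nonneg h1 hx.le]
    · have : -y * a < -x * b := by
        apply lt_of_pow_lt_pow_left₀ 2 (by nlinarith)
        nlinarith
      linarith

theorem IsStationaryGraph.integral_eq_zero_of_contDiff {f : ℝ × ℝ → ℝ} (hf : LocallyLipschitz f)
    (h : IsStationaryGraph f) {φ : ℝ × ℝ → ℝ} (hφ : ContDiff ℝ ∞ φ) (hc : HasCompactSupport φ) :
    ∫ p, tilt (intrinsicGradient f p) * graphDivergence f φ p = 0 := by
  have hφL : LocallyLipschitz φ := (hφ.of_le (by exact_mod_cast le_top)).locallyLipschitz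
  have hfm := hf.continuous.measurable
  have hφm := hφ.continuous.measurable
  set G := intrinsicGradient f with hG
  set A := graphDivergence f φ with hA
  set B : ℝ × ℝ → ℝ := fun p => φ p * fderiv ℝ φ p (0, 1) with hB
  have hGm : Measurable G := by
    rw [hG, funext (intrinsicGradient_eq f)]
    exact measurable_fderiv_graph f hf.continuous
  have hAm : Measurable A := measurable_graphDivergence hf.continuous hφ.continuous
  have hBm : Measurable B := hφm.mul (measurable_fderiv_apply_const ℝ φ _)
  have hS := hc.isCompact
  obtain ⟨D, -, hD⟩ := hφL.exists_norm_fderiv_le hS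
  obtain ⟨D', -, hD'⟩ := hf.exists_norm_fderiv_le hS
  obtain ⟨M, hM⟩ := hS.exists_bound_of_continuousOn hf.continuous.continuousOn
  obtain ⟨N, hN⟩ := hS.exists_bound_of_continuousOn hφ.continuous.continuousOn
  obtain ⟨CA, hCA⟩ := exists_abs_graphDivergence_le (f := f) (φ := φ) hf hφL hS
  have hBb : ∀ p ∈ tsupport φ, |B p| ≤ N * D := fun p hp => by
    rw [hB, abs_mul]
    exact mul_le_mul (hN p hp) (abs_fderiv_snd_le (hD p hp)) (abs_nonneg _)
      ((norm_nonneg _).trans (hN p hp))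
  have hGb : ∀ p ∈ tsupport φ, |G p| ≤ D' * (1 + M) := fun p hp => by
    rw [hG, intrinsicGradient_eq]
    exact abs_fderiv_graph_le (hD' p hp) (hM p hp)
  -- The intrinsic gradient of `f + ε φ` is quadratic in `ε`; its linear coefficient is the
  -- divergence `A`.
  set q : ℝ → ℝ × ℝ → ℝ := fun ε p => G p + ε * A p + ε ^ 2 * B p with hq
  have hqm : ∀ ε, Measurable (q ε) := fun ε =>
    (hGm.add (hAm.const_mul ε)).add (hBm.const_mul (ε ^ 2))
  have harea : ∀ ε, graphArea (fun p => f p + ε * φ p) (tsupport φ) =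
      ∫ p in tsupport φ, Real.sqrt (1 + q ε p ^ 2) := fun ε => by
    unfold graphArea
    apply integral_congr_ae
    filter_upwards [ae_restrict_of_ae hf.ae_differentiableAt] with p hp
    have hφd : DifferentiableAt ℝ φ p := (hφ.differentiable (by simp)).differentiableAt
    have e : intrinsicGradient (fun p => f p + ε * φ p) p = q ε p := by
      simp only [hq, hG, hA, hB]
      rw [intrinsicGradient_eq, intrinsicGradient_eq, graphDivergence,
        fderiv_fun_add hp (hφd.const_mul ε), fderiv_const_mul hφd]
      have split : ∀ (L : ℝ × ℝ →L[ℝ] ℝ) (x : ℝ), L (1, x) = L (1, 0) + x * L (0, 1) := by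
        intro L x
        have : ((1 : ℝ), x) = (1, 0) + x • ((0 : ℝ), (1 : ℝ)) := by simp
        rw [this, map_add, map_smul]; rfl
      simp only [add_apply, smul_apply, smul_eq_mul]
      rw [split (fderiv ℝ f p), split (fderiv ℝ φ p), split (fderiv ℝ f p) (f p),
        split (fderiv ℝ φ p) (f p)]
      ring
    simp only [e]
  have hsqm : ∀ ε, Measurable fun p => Real.sqrt (1 + q ε p ^ 2) := fun ε =>
    (((hqm ε).pow_const 2).const_add 1).sqrt
  have htm : Measurable tilt := contDiff_tilt.continuous.measurable
  have hfin : volume (tsupport φ) ≠ ⊤ := hS.measure_lt_top.ne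
  have key := hasDerivAt_integral_of_dominated_loc_of_deriv_le
    (μ := volume.restrict (tsupport φ)) (F := fun ε p => Real.sqrt (1 + q ε p ^ 2))
    (F' := fun ε p => tilt (q ε p) * (A p + 2 * ε * B p)) (x₀ := (0 : ℝ))
    (s := Metric.ball 0 1) (bound := fun _ => CA + 2 * (N * D))
    (Metric.ball_mem_nhds _ one_pos)
    (Filter.Eventually.of_forall fun ε => (hsqm ε).aestronglyMeasurable)
    (by
      refine Measure.integrableOn_of_bounded (M := Real.sqrt (1 + (D' * (1 + M)) ^ 2)) hfin
        (hsqm 0).aestronglyMeasurable ?_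
      filter_upwards [ae_restrict_mem hS.measurableSet] with p hp
      rw [Real.norm_eq_abs, abs_of_nonneg (Real.sqrt_nonneg _)]
      apply Real.sqrt_le_sqrt
      have : q 0 p = G p := by simp [hq]
      rw [this, ← sq_abs (G p)]
      have := hGb p hp
      gcongr)
    ((htm.comp (hqm 0)).mul (hAm.add (hBm.const_mul (2 * 0)))).aestronglyMeasurable
    (by
      filter_upwards [ae_restrict_mem hS.measurableSet] with p hp ε hε
      rw [Real.norm_eq_abs, abs_mul]
      rw [mem_ball_zero_iff, Real.norm_eq_abs] at hε
      have h1 : |A p + 2 * ε * B p| ≤ CA + 2 * (N * D) := by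
        refine (abs_add_le _ _).trans (add_le_add (hCA p hp) ?_)
        rw [abs_mul, abs_mul, abs_two]
        nlinarith [hBb p hp, abs_nonneg (B p), abs_nonneg ε]
      nlinarith [abs_tilt_le_one (q ε p), abs_nonneg (A p + 2 * ε * B p)])
    (integrableOn_const hfin)
    (by
      refine Filter.Eventually.of_forall fun p ε _ => ?_
      refine hasDerivAt_sqrt_one_add_sq (q := fun ε => q ε p) ?_
      have := (((hasDerivAt_id ε).mul_const (A p)).const_add (G p)).add
        (((hasDerivAt_id ε).pow 2).mul_const (B p))
      refine this.congr_deriv ?_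
      simp)
  have hz := key.2.unique (by simpa only [harea] using h φ hφ hc)
  rw [setIntegral_eq_integral_of_forall_compl_eq_zero (fun p hp => by
    simp [hA, hB, graphDivergence_eq_zero hp, image_eq_zero_of_notMem_tsupport hp])] at hz
  simpa [hq] using hz

/-! ### Lipschitz test functions by mollification -/

open Filter Topology Convolution in
/-- Mollification of compactly supported Lipschitz functions. -/
theorem LipschitzWith.exists_smooth_approximation {φ : ℝ × ℝ → ℝ} {K : NNReal}
    (hφ : LipschitzWith K φ) (hc : HasCompactSupport φ) :
    ∃ (Φ : ℕ → ℝ × ℝ → ℝ) (S : Set (ℝ × ℝ)), IsCompact S ∧ (∀ n, ContDiff ℝ ∞ (Φ n)) ∧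
      (∀ n, tsupport (Φ n) ⊆ S) ∧ (∀ n, LipschitzWith K (Φ n)) ∧
      (∀ p, Tendsto (fun n => Φ n p) atTop (𝓝 (φ p))) ∧
      ∀ v, ∀ᵐ p, Tendsto (fun n => fderiv ℝ (Φ n) p v) atTop (𝓝 (fderiv ℝ φ p v)) := by
  have hpos : ∀ n : ℕ, (0 : ℝ) < 1 / (2 * (n + 1)) := fun n => by positivity
  -- The bounded ratio of outer to inner radius is needed for convergence at Lebesgue points; outer
  -- radii at most `1` keep all supports in one ball.
  let ρ : ℕ → ContDiffBump (0 : ℝ × ℝ) := fun n =>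
    ⟨1 / (2 * (n + 1)), 2 * (1 / (2 * (n + 1))), hpos n, by linarith [hpos n]⟩
  have hout : ∀ n, (ρ n).rOut = 1 / ((n : ℝ) + 1) := fun n => by
    change 2 * (1 / (2 * ((n : ℝ) + 1))) = _
    field_simp
  have hlim : Tendsto (fun n => (ρ n).rOut) atTop (𝓝 0) := by
    simp only [hout]; exact tendsto_one_div_add_atTop_nhds_zero_nat
  have hratio : ∀ᶠ n in atTop, (ρ n).rOut ≤ 2 * (ρ n).rIn := Eventually.of_forall fun n => le_rfl
  set Φ : ℕ → ℝ × ℝ → ℝ := fun n =>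
    ((ρ n).normed volume ⋆[ContinuousLinearMap.lsmul ℝ ℝ, volume] φ) with hΦ
  have hint : ∀ n, Integrable ((ρ n).normed (volume : Measure (ℝ × ℝ))) := fun n =>
    (ρ n).integrable_normed
  have hmeas : ∀ n, Continuous ((ρ n).normed (volume : Measure (ℝ × ℝ))) := fun n =>
    (ρ n).continuous_normed
  have hnn : ∀ n p, 0 ≤ (ρ n).normed (volume : Measure (ℝ × ℝ)) p := fun n p =>
    (ρ n).nonneg_normed p
  obtain ⟨Mφ, hMφ⟩ := hc.exists_bound_of_continuous hφ.continuous
  have hval : ∀ n p, Φ n p = ∫ t, (ρ n).normed volume t * φ (p - t) := fun n p => rfl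
  have hI : ∀ n p, Integrable fun t => (ρ n).normed volume t * φ (p - t) := fun n p => by
    refine (hint n).mul_bdd (c := Mφ) ?_ (Eventually.of_forall fun t => hMφ _)
    exact (hφ.continuous.comp (by fun_prop)).aestronglyMeasurable
  have hLip : ∀ n, LipschitzWith K (Φ n) := fun n => by
    refine LipschitzWith.of_dist_le_mul fun p q => ?_
    rw [Real.dist_eq, hval, hval, ← integral_sub (hI n p) (hI n q), ← Real.norm_eq_abs]
    calc ‖∫ t, ((ρ n).normed volume t * φ (p - t) - (ρ n).normed volume t * φ (q - t))‖
        ≤ ∫ t, (ρ n).normed volume t * (K * dist p q) := by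
          refine norm_integral_le_of_norm_le ((hint n).mul_const _) (Eventually.of_forall fun t => ?_)
          rw [← mul_sub, norm_mul, Real.norm_of_nonneg (hnn n t)]
          refine mul_le_mul_of_nonneg_left ?_ (hnn n t)
          have := hφ.dist_le_mul (p - t) (q - t)
          rwa [dist_sub_right, dist_eq_norm] at this
      _ = K * dist p q := by rw [integral_mul_const, (ρ n).integral_normed, one_mul]
  have hsmooth : ∀ n, ContDiff ℝ ∞ (Φ n) := fun n =>
    (ρ n).hasCompactSupport_normed.contDiff_convolution_left _ (ρ n).contDiff_normed
      hφ.continuous.locallyIntegrable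
  obtain ⟨R, hR0, hR⟩ := hc.exists_tsupport_subset_ball
  -- The derivative falls on the Lipschitz factor, so derivatives of mollifications are
  -- mollifications of the a.e. derivative.
  have hfd : ∀ n p v, fderiv ℝ (Φ n) p v =
      ((ρ n).normed volume ⋆[ContinuousLinearMap.lsmul ℝ ℝ, volume] fun q => fderiv ℝ φ q v) p := by
    intro n p v
    have h1 : HasDerivAt (fun u : ℝ => Φ n (p + u • v)) (fderiv ℝ (Φ n) p v) 0 := by
      have := ((hsmooth n).differentiable (by simp)).differentiableAt (x := p)
      exact this.hasFDerivAt.hasLineDerivAt v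
    have h2 := hasDerivAt_integral_of_dominated_loc_of_lip (μ := (volume : Measure (ℝ × ℝ)))
      (F := fun (u : ℝ) t => (ρ n).normed volume t * φ (p + u • v - t)) (x₀ := (0 : ℝ))
      (s := univ) (F' := fun t => (ρ n).normed volume t * fderiv ℝ φ (p - t) v)
      (bound := fun t => (ρ n).normed volume t * (K * ‖v‖)) univ_mem
      (Eventually.of_forall fun u => (hI n _).aestronglyMeasurable) (hI n _)
      ((hmeas n).aestronglyMeasurable.mul (((measurable_fderiv_apply_const ℝ φ v).comp
        (measurable_const.sub measurable_id)).aestronglyMeasurable))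
      (Eventually.of_forall fun t => by
        refine LipschitzWith.lipschitzOnWith (LipschitzWith.of_dist_le_mul fun a b => ?_)
        rw [Real.coe_nnabs, abs_of_nonneg (mul_nonneg (hnn n t) (by positivity)), Real.dist_eq,
          ← mul_sub, abs_mul, abs_of_nonneg (hnn n t), mul_assoc]
        refine mul_le_mul_of_nonneg_left ?_ (hnn n t)
        have := hφ.dist_le_mul (p + a • v - t) (p + b • v - t)
        rw [dist_sub_right, dist_add_left, dist_eq_norm, dist_eq_norm, ← sub_smul, norm_smul] at this
        rw [Real.dist_eq, ← Real.norm_eq_abs, ← Real.norm_eq_abs, mul_assoc, mul_comm ‖v‖]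
        exact this)
      ((hint n).mul_const _)
      (by
        have := (quasiMeasurePreserving_sub_left (volume : Measure (ℝ × ℝ)) p).ae
          hφ.ae_differentiableAt
        filter_upwards [this] with t ht
        have h3 := (ht.hasFDerivAt.hasLineDerivAt v).const_mul ((ρ n).normed volume t)
        have e : ∀ u : ℝ, p + u • v - t = p - t + u • v := fun u => by abel
        simpa only [e] using h3)
    exact h1.unique h2.2
  refine ⟨Φ, Metric.closedBall 0 (R + 1), isCompact_closedBall _ _, hsmooth, fun n => ?_, hLip,
    fun p => ContDiffBump.convolution_tendsto_right_of_continuous hlim hφ.continuous p, fun v => ?_⟩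
  · refine closure_minimal ?_ Metric.isClosed_closedBall
    refine (support_convolution_subset _).trans ?_
    rintro _ ⟨a, ha, b, hb, rfl⟩
    rw [(ρ n).support_normed_eq, mem_ball_zero_iff, hout] at ha
    have hb' := hR (subset_tsupport _ hb)
    rw [mem_ball_zero_iff] at hb'
    rw [mem_closedBall_zero_iff]
    have : 1 / ((n : ℝ) + 1) ≤ 1 := by
      rw [div_le_one (by positivity)]; linarith [Nat.cast_nonneg (α := ℝ) n]
    exact (norm_add_le _ _).trans (by linarith)
  · have hl : LocallyIntegrable (fun q => fderiv ℝ φ q v) := by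
      refine LocallyIntegrable.congr (hφ.locallyIntegrable_lineDeriv (μ := volume) v) ?_
      filter_upwards [hφ.ae_differentiableAt] with q hq
      exact hq.lineDeriv_eq_fderiv
    filter_upwards [ContDiffBump.ae_convolution_tendsto_right_of_locallyIntegrable hlim hratio hl]
      with p hp
    simpa only [hfd] using hp

open Filter Topology in
/-- The Euler-Lagrange equation, tested against Lipschitz functions. -/
theorem IsStationaryGraph.integral_eq_zero {f : ℝ × ℝ → ℝ} (hf : LocallyLipschitz f)
    (h : IsStationaryGraph f) {φ : ℝ × ℝ → ℝ} (hφ : LocallyLipschitz φ)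
    (hc : HasCompactSupport φ) :
    ∫ p, tilt (intrinsicGradient f p) * graphDivergence f φ p = 0 := by
  obtain ⟨K, hK⟩ := hφ.exists_lipschitzWith_of_hasCompactSupport hc
  obtain ⟨Φ, S, hS, hsm, hsup, hLip, hlim, hdlim⟩ := hK.exists_smooth_approximation hc
  have hcn : ∀ n, HasCompactSupport (Φ n) := fun n => hS.of_isClosed_subset
    (isClosed_tsupport _) (hsup n)
  obtain ⟨R, hR⟩ := hS.isBounded.subset_ball 0
  obtain ⟨B, hB0, hB⟩ := hf.exists_norm_fderiv_le hS
  obtain ⟨M, hM⟩ := hS.exists_bound_of_continuousOn hf.continuous.continuousOn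
  -- `(R, 0)` lies outside the open ball containing the supports, so every `Φ n` vanishes there and
  -- the Lipschitz bound controls its size.
  have hΦb : ∀ n, ∀ p ∈ S, |Φ n p| ≤ K * (R + |R|) := fun n p hp => by
    have hz : Φ n (R, 0) = 0 := by
      apply image_eq_zero_of_notMem_tsupport
      intro hm
      have := hR (hsup n hm)
      rw [mem_ball_zero_iff, Prod.norm_def] at this
      have h2 := (le_max_left _ _).trans_lt this
      simp only [Real.norm_eq_abs] at h2
      exact absurd h2 (not_lt.2 (le_abs_self R))
    have h1 := (hLip n).dist_le_mul p (R, 0)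
    rw [hz, Real.dist_eq, sub_zero] at h1
    refine h1.trans (mul_le_mul_of_nonneg_left ?_ K.2)
    refine (dist_triangle p 0 _).trans (add_le_add (hR hp).le ?_)
    rw [dist_zero_left, Prod.norm_def]
    simp
  have hGm : Measurable (fun p => tilt (intrinsicGradient f p)) := by
    rw [funext (intrinsicGradient_eq f)]
    exact contDiff_tilt.continuous.measurable.comp (measurable_fderiv_graph f hf.continuous)
  set C := K * (1 + M) + K * (R + |R|) * B with hC
  have key := tendsto_integral_of_dominated_convergence
    (μ := (volume : Measure (ℝ × ℝ)))
    (F := fun n p => tilt (intrinsicGradient f p) * graphDivergence f (Φ n) p)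
    (f := fun p => tilt (intrinsicGradient f p) * graphDivergence f φ p)
    (S.indicator fun _ => C)
    (fun n => (hGm.mul (measurable_graphDivergence hf.continuous
      (hLip n).continuous)).aestronglyMeasurable)
    ((integrable_indicator_iff hS.measurableSet).2 (integrableOn_const hS.measure_lt_top.ne))
    (fun n => Eventually.of_forall fun p => by
      by_cases hp : p ∈ S
      · rw [indicator_of_mem hp, Real.norm_eq_abs, abs_mul]
        have h1 : |graphDivergence f (Φ n) p| ≤ C := by
          refine (abs_add_le _ _).trans (add_le_add (abs_fderiv_graph_le
            (norm_fderiv_le_of_lipschitz ℝ (hLip n)) (hM p hp)) ?_)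
          rw [abs_mul]
          exact mul_le_mul (hΦb n p hp) (abs_fderiv_snd_le (hB p hp)) (abs_nonneg _)
            ((abs_nonneg _).trans (hΦb n p hp))
        nlinarith [abs_tilt_le_one (intrinsicGradient f p), abs_nonneg (graphDivergence f (Φ n) p)]
      · rw [indicator_of_notMem hp, graphDivergence_eq_zero fun h => hp (hsup n h)]
        simp)
    (by
      filter_upwards [hdlim (1, 0), hdlim (0, 1)] with p h1 h2
      have split : ∀ (L : ℝ × ℝ →L[ℝ] ℝ), L (1, f p) = L (1, 0) + f p * L (0, 1) := by
        intro L
        have : ((1 : ℝ), f p) = (1, 0) + f p • ((0 : ℝ), (1 : ℝ)) := by simp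
        rw [this, map_add, map_smul]; rfl
      simp only [graphDivergence, split]
      exact ((h1.add (h2.const_mul _)).add ((hlim p).mul_const _)).const_mul _)
  simp only [h.integral_eq_zero_of_contDiff hf (hsm _) (hcn _)] at key
  exact (tendsto_nhds_unique key tendsto_const_nhds)

/-! ### The flow of a bounded Lipschitz field -/

/-- `X r t` solves `γ' = F (s, γ)`, `γ r = t` on `[s₁, s₂]`, for a bounded Lipschitz field `F`. -/
structure IsLipschitzFlow (F : ℝ × ℝ → ℝ) (K M : NNReal) (s₁ s₂ : ℝ) (X : ℝ → ℝ → ℝ → ℝ) :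
    Prop where
  lt : s₁ < s₂
  lipschitz : LipschitzWith K F
  bound : ∀ q, |F q| ≤ M
  init : ∀ r ∈ Icc s₁ s₂, ∀ t, X r t r = t
  continuousOn : ∀ r ∈ Icc s₁ s₂, ∀ t, ContinuousOn (X r t) (Icc s₁ s₂)
  hasDerivAt : ∀ r ∈ Icc s₁ s₂, ∀ t, ∀ s ∈ Ioo s₁ s₂, HasDerivAt (X r t) (F (s, X r t s)) s

theorem LipschitzWith.exists_isLipschitzFlow {F : ℝ × ℝ → ℝ} {K M : NNReal}
    (hF : LipschitzWith K F) (hM : ∀ q, |F q| ≤ M) {s₁ s₂ : ℝ} (h : s₁ < s₂) :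
    ∃ X, IsLipschitzFlow F K M s₁ s₂ X := by
  have key : ∀ r t, ∃ γ : ℝ → ℝ, r ∈ Icc s₁ s₂ → γ r = t ∧
      ∀ s ∈ Icc s₁ s₂, HasDerivWithinAt γ (F (s, γ s)) (Icc s₁ s₂) s := by
    intro r t
    by_cases hr : r ∈ Icc s₁ s₂
    -- Speed at most `M` cannot leave the ball of radius `M (s₂ - s₁)`, so Picard–Lindelöf covers
    -- the whole interval.
    · have hP : IsPicardLindelof (fun s x => F (s, x)) (⟨r, hr⟩ : Icc s₁ s₂) t
          (M * (s₂ - s₁).toNNReal) 0 M K :=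
        { lipschitzOnWith := fun s _ => by
            have := (hF.comp (LipschitzWith.prodMk_left s)).lipschitzOnWith
              (s := Metric.closedBall t (M * (s₂ - s₁).toNNReal : NNReal))
            simpa [Function.comp_def] using this
          continuousOn := fun x _ => (hF.continuous.comp (by fun_prop)).continuousOn
          norm_le := fun s _ x _ => hM _
          mul_max_le := by
            push_cast
            rw [Real.coe_toNNReal _ (by linarith), sub_zero]
            refine mul_le_mul_of_nonneg_left (max_le ?_ ?_) M.2
            · linarith [hr.1]
            · linarith [hr.2] }
      obtain ⟨γ, h0, h1⟩ := hP.exists_eq_forall_mem_Icc_hasDerivWithinAt₀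
      exact ⟨γ, fun _ => ⟨h0, h1⟩⟩
    · exact ⟨fun _ => 0, fun h => absurd h hr⟩
  choose X hX using key
  exact ⟨X, h, hF, hM, fun r hr t => (hX r t hr).1,
    fun r hr t s hs => ((hX r t hr).2 s hs).continuousWithinAt,
    fun r hr t s hs => ((hX r t hr).2 s (Ioo_subset_Icc_self hs)).hasDerivAt
      (Icc_mem_nhds hs.1 hs.2)⟩

namespace IsLipschitzFlow

variable {F : ℝ × ℝ → ℝ} {K M : NNReal} {s₁ s₂ : ℝ} {X : ℝ → ℝ → ℝ → ℝ}

/-- The nearest point retraction onto `[s₁, s₂]`. -/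
noncomputable def clamp (s₁ s₂ s : ℝ) : ℝ := max s₁ (min s₂ s)

theorem clamp_mem (h : s₁ ≤ s₂) (s : ℝ) : clamp s₁ s₂ s ∈ Icc s₁ s₂ :=
  ⟨le_max_left _ _, max_le h (min_le_left _ _)⟩

theorem clamp_of_mem {s : ℝ} (hs : s ∈ Icc s₁ s₂) : clamp s₁ s₂ s = s := by
  rw [clamp, min_eq_right hs.2, max_eq_right hs.1]

theorem lipschitzWith_clamp : LipschitzWith 1 (clamp s₁ s₂) :=
  (LipschitzWith.id.const_min _).const_max _

theorem left_mem (h : IsLipschitzFlow F K M s₁ s₂ X) : s₁ ∈ Icc s₁ s₂ := left_mem_Icc.2 h.lt.le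

theorem right_mem (h : IsLipschitzFlow F K M s₁ s₂ X) : s₂ ∈ Icc s₁ s₂ := right_mem_Icc.2 h.lt.le

theorem abs_deriv_sub_le (h : IsLipschitzFlow F K M s₁ s₂ X) (s x y : ℝ) :
    |F (s, x) - F (s, y)| ≤ K * |x - y| :=
  (lipschitzOnWith_univ.2 h.lipschitz).abs_sub_le_snd (mem_univ _) (mem_univ _)

theorem flow_flow (h : IsLipschitzFlow F K M s₁ s₂ X) {r r' s : ℝ} (hr : r ∈ Icc s₁ s₂)
    (hr' : r' ∈ Icc s₁ s₂) (hs : s ∈ Icc s₁ s₂) (t : ℝ) : X r' (X r t r') s = X r t s :=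
  h.lipschitz.locallyLipschitz.eqOn_of_hasDerivAt (h.continuousOn r' hr' _)
    (h.continuousOn r hr t) (h.hasDerivAt r' hr' _) (h.hasDerivAt r hr t) hr' (h.init _ hr' _) hs

theorem abs_sub_le (h : IsLipschitzFlow F K M s₁ s₂ X) {r s : ℝ} (hr : r ∈ Icc s₁ s₂)
    (hs : s ∈ Icc s₁ s₂) (t t' : ℝ) :
    |X r t s - X r t' s| ≤ Real.exp (K * (s₂ - s₁)) * |t - t'| := by
  have := abs_le_exp_mul_of_abs_deriv_le (K := K)
    ((h.continuousOn r hr t).sub (h.continuousOn r hr t'))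
    (fun s hs => (h.hasDerivAt r hr t s hs).sub (h.hasDerivAt r hr t' s hs))
    (fun s _ => h.abs_deriv_sub_le s _ _) hr hs
  simp only [Pi.sub_apply, h.init r hr] at this
  refine this.trans (mul_le_mul_of_nonneg_right (Real.exp_le_exp.2
    (mul_le_mul_of_nonneg_left ?_ K.2)) (abs_nonneg _))
  rw [abs_le]
  constructor <;> linarith [hr.1, hr.2, hs.1, hs.2]

theorem flow_lt (h : IsLipschitzFlow F K M s₁ s₂ X) {r s : ℝ} (hr : r ∈ Icc s₁ s₂)
    (hs : s ∈ Icc s₁ s₂) {t t' : ℝ} (ht : t < t') : X r t s < X r t' s := by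
  have := pos_of_abs_deriv_le (K := K)
    ((h.continuousOn r hr t').sub (h.continuousOn r hr t))
    (fun s hs => (h.hasDerivAt r hr t' s hs).sub (h.hasDerivAt r hr t s hs))
    (fun s _ => h.abs_deriv_sub_le s _ _) hr hs
    (by simp only [Pi.sub_apply, h.init r hr]; linarith)
  simpa using this

theorem abs_sub_le_time (h : IsLipschitzFlow F K M s₁ s₂ X) {r s s' : ℝ} (hr : r ∈ Icc s₁ s₂)
    (hs : s ∈ Icc s₁ s₂) (hs' : s' ∈ Icc s₁ s₂) (t : ℝ) :
    |X r t s - X r t s'| ≤ M * |s - s'| := by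
  have key : ∀ s ∈ Icc s₁ s₂, ∀ s' ∈ Icc s₁ s₂, s < s' →
      |X r t s' - X r t s| ≤ M * |s' - s| := by
    intro s hs s' hs' hlt
    obtain ⟨c, hc, hcs⟩ := exists_hasDerivAt_eq_slope (X r t) _ hlt
      ((h.continuousOn r hr t).mono (Icc_subset_Icc hs.1 hs'.2))
      (fun x hx => h.hasDerivAt r hr t x ⟨hs.1.trans_lt hx.1, hx.2.trans_le hs'.2⟩)
    rw [eq_div_iff (by linarith)] at hcs
    rw [← hcs, abs_mul]
    exact mul_le_mul_of_nonneg_right (h.bound _) (abs_nonneg _)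
  rcases lt_trichotomy s s' with hlt | rfl | hlt
  · rw [abs_sub_comm, abs_sub_comm s]; exact key s hs s' hs' hlt
  · simp
  · exact key s' hs' s hs hlt

/-- The value at time `s₁` of the solution through `q`. -/
noncomputable def label (X : ℝ → ℝ → ℝ → ℝ) (s₁ s₂ : ℝ) (q : ℝ × ℝ) : ℝ :=
  X (clamp s₁ s₂ q.1) q.2 s₁

theorem label_flow (h : IsLipschitzFlow F K M s₁ s₂ X) {r s : ℝ} (hr : r ∈ Icc s₁ s₂)
    (hs : s ∈ Icc s₁ s₂) (t : ℝ) : label X s₁ s₂ (s, X r t s) = X r t s₁ := by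
  rw [label, clamp_of_mem hs]
  exact h.flow_flow hr hs h.left_mem t

theorem flow_label (h : IsLipschitzFlow F K M s₁ s₂ X) (q : ℝ × ℝ) :
    X s₁ (label X s₁ s₂ q) (clamp s₁ s₂ q.1) = q.2 := by
  rw [label, h.flow_flow (clamp_mem h.lt.le _) h.left_mem (clamp_mem h.lt.le _),
    h.init _ (clamp_mem h.lt.le _)]

theorem locallyLipschitz_of_dist_le {u : ℝ × ℝ → ℝ} {A : ℝ} (hA : 0 ≤ A)
    (hu : ∀ p q, |u p - u q| ≤ A * dist p q) : LocallyLipschitz u :=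
  (LipschitzWith.of_dist_le_mul (K := ⟨A, hA⟩) fun p q => hu p q).locallyLipschitz

theorem abs_clamp_sub_le (p q : ℝ × ℝ) :
    |clamp s₁ s₂ p.1 - clamp s₁ s₂ q.1| ≤ dist p q := by
  have := (lipschitzWith_clamp (s₁ := s₁) (s₂ := s₂)).dist_le_mul p.1 q.1
  rw [NNReal.coe_one, one_mul] at this
  exact this.trans (le_max_left _ _)

theorem locallyLipschitz_label (h : IsLipschitzFlow F K M s₁ s₂ X) :
    LocallyLipschitz (label X s₁ s₂) := by
  refine locallyLipschitz_of_dist_le (A := Real.exp (K * (s₂ - s₁)) * (1 + M)) (by positivity)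
    fun p q => ?_
  have hp := clamp_mem h.lt.le p.1
  have hq := clamp_mem h.lt.le q.1
  -- Carry `p` along its solution to the clamped time of `q`; from there the two labels differ only
  -- through the initial heights.
  rw [label, label, ← h.flow_flow hp hq h.left_mem]
  refine (h.abs_sub_le hq h.left_mem _ _).trans ?_
  rw [mul_assoc]
  refine mul_le_mul_of_nonneg_left ?_ (Real.exp_pos _).le
  have h1 := h.abs_sub_le_time hp hq hp p.2
  rw [h.init _ hp, abs_sub_comm (clamp s₁ s₂ q.1)] at h1
  have h2 := mul_le_mul_of_nonneg_left (abs_clamp_sub_le (s₁ := s₁) (s₂ := s₂) p q) M.2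
  have h3 : |p.2 - q.2| ≤ dist p q := le_max_right _ _
  have e : X (clamp s₁ s₂ p.1) p.2 (clamp s₁ s₂ q.1) - q.2 =
    (X (clamp s₁ s₂ p.1) p.2 (clamp s₁ s₂ q.1) - p.2) + (p.2 - q.2) := by ring
  rw [e]
  refine (abs_add_le _ _).trans ?_
  change (M : ℝ) * _ ≤ (M : ℝ) * _ at h2
  linarith

theorem locallyLipschitz_flow (h : IsLipschitzFlow F K M s₁ s₂ X) :
    LocallyLipschitz fun p : ℝ × ℝ => X s₁ p.2 (clamp s₁ s₂ p.1) := by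
  refine locallyLipschitz_of_dist_le (A := Real.exp (K * (s₂ - s₁)) + M) (by positivity)
    fun p q => ?_
  have hp := clamp_mem h.lt.le p.1
  have hq := clamp_mem h.lt.le q.1
  have h1 := h.abs_sub_le_time h.left_mem hp hq p.2
  have h2 := h.abs_sub_le h.left_mem hq p.2 q.2
  have h3 := mul_le_mul_of_nonneg_left (abs_clamp_sub_le (s₁ := s₁) (s₂ := s₂) p q) M.2
  have h4 : |p.2 - q.2| ≤ dist p q := le_max_right _ _
  have h5 := mul_le_mul_of_nonneg_left h4 (Real.exp_pos (K * (s₂ - s₁))).le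
  change (M : ℝ) * _ ≤ (M : ℝ) * _ at h3
  have e : X s₁ p.2 (clamp s₁ s₂ p.1) - X s₁ q.2 (clamp s₁ s₂ q.1) =
    (X s₁ p.2 (clamp s₁ s₂ p.1) - X s₁ p.2 (clamp s₁ s₂ q.1)) +
      (X s₁ p.2 (clamp s₁ s₂ q.1) - X s₁ q.2 (clamp s₁ s₂ q.1)) := by ring
  rw [e]
  refine (abs_add_le _ _).trans ?_
  linarith

theorem abs_label_sub_le (h : IsLipschitzFlow F K M s₁ s₂ X) {q : ℝ × ℝ} (hq : q.1 ∈ Icc s₁ s₂) :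
    |label X s₁ s₂ q - q.2| ≤ M * (s₂ - s₁) := by
  have := h.abs_sub_le_time hq h.left_mem hq q.2
  rw [h.init _ hq] at this
  rw [label, clamp_of_mem hq]
  refine this.trans (mul_le_mul_of_nonneg_left ?_ M.2)
  rw [abs_sub_comm, abs_of_nonneg (by linarith [hq.1])]
  linarith [hq.2]

/-- The flow strip around the characteristic with label `τ₀`. -/
def strip (X : ℝ → ℝ → ℝ → ℝ) (s₁ s₂ τ₀ ρ : ℝ) : Set (ℝ × ℝ) :=
  {q | q.1 ∈ Icc s₁ s₂ ∧ |label X s₁ s₂ q - τ₀| ≤ ρ}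

theorem abs_snd_sub_le_of_mem_strip (h : IsLipschitzFlow F K M s₁ s₂ X) {τ₀ ρ : ℝ} {q : ℝ × ℝ}
    (hq : q ∈ strip X s₁ s₂ τ₀ ρ) : |q.2 - τ₀| ≤ ρ + M * (s₂ - s₁) := by
  have h1 := h.abs_label_sub_le hq.1
  have e : q.2 - τ₀ = (label X s₁ s₂ q - τ₀) - (label X s₁ s₂ q - q.2) := by ring
  rw [e]
  exact (abs_sub _ _).trans (add_le_add hq.2 h1)

theorem isCompact_strip (h : IsLipschitzFlow F K M s₁ s₂ X) (τ₀ ρ : ℝ) :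
    IsCompact (strip X s₁ s₂ τ₀ ρ) := by
  have hcl : IsClosed (strip X s₁ s₂ τ₀ ρ) :=
    (isClosed_Icc.preimage continuous_fst).inter (isClosed_le
      (h.locallyLipschitz_label.continuous.sub continuous_const).abs continuous_const)
  refine (isCompact_Icc.prod (isCompact_Icc (a := τ₀ - (ρ + M * (s₂ - s₁)))
    (b := τ₀ + (ρ + M * (s₂ - s₁))))).of_isClosed_subset hcl fun q hq => ⟨hq.1, ?_⟩
  have := abs_le.1 (h.abs_snd_sub_le_of_mem_strip hq)
  constructor <;> linarith [this.1, this.2]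

/-- Differentiation along the solution through `q`. -/
theorem hasDerivAt_comp (h : IsLipschitzFlow F K M s₁ s₂ X) {q : ℝ × ℝ} (hq : q.1 ∈ Ioo s₁ s₂)
    {u : ℝ × ℝ → ℝ} (hu : DifferentiableAt ℝ u q) :
    HasDerivAt (fun r => u (r, X q.1 q.2 r)) (fderiv ℝ u q (1, F q)) q.1 := by
  have hq' := Ioo_subset_Icc_self hq
  have e : (q.1, X q.1 q.2 q.1) = q := by rw [h.init _ hq']
  have h1 := h.hasDerivAt _ hq' q.2 _ hq
  rw [e] at h1
  have := DifferentiableAt.hasDerivAt_comp_graph (u := u) (s := q.1) (γ := X q.1 q.2)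
    (by rwa [e]) h1
  rwa [e] at this

theorem label_comp (h : IsLipschitzFlow F K M s₁ s₂ X) {q : ℝ × ℝ} (hq : q.1 ∈ Icc s₁ s₂)
    {r : ℝ} (hr : r ∈ Icc s₁ s₂) :
    label X s₁ s₂ (r, X q.1 q.2 r) = label X s₁ s₂ q := by
  rw [h.label_flow hq hr, label, clamp_of_mem hq]

end IsLipschitzFlow

/-! ### The gap between flow lines as a discrete Jacobian -/

theorem LocallyLipschitz.inv_real {X : Type*} [PseudoEMetricSpace X] {u : X → ℝ}
    (hu : LocallyLipschitz u) (h0 : ∀ x, u x ≠ 0) : LocallyLipschitz fun x => (u x)⁻¹ := by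
  intro x
  obtain ⟨K, s, hs, hK⟩ := hu x
  obtain ⟨K', t, ht, hK'⟩ := (contDiffAt_inv ℝ (h0 x) (n := 1)).exists_lipschitzOnWith
  refine ⟨K' * K, s ∩ u ⁻¹' t, Filter.inter_mem hs (hu.continuous.continuousAt ht), ?_⟩
  exact hK'.comp (hK.mono inter_subset_left) fun y hy => hy.2

theorem ae_fst_ne (c : ℝ) : ∀ᵐ q : ℝ × ℝ, q.1 ≠ c := by
  rw [ae_iff]
  have : {q : ℝ × ℝ | ¬q.1 ≠ c} = {c} ×ˢ univ := by ext q; simp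
  rw [this, Measure.volume_eq_prod, Measure.prod_prod]
  simp

namespace IsLipschitzFlow

variable {F : ℝ × ℝ → ℝ} {K M : NNReal} {s₁ s₂ : ℝ} {X : ℝ → ℝ → ℝ → ℝ}

/-- The vertical distance to the solution whose label is larger by `δ`. -/
noncomputable def gap (X : ℝ → ℝ → ℝ → ℝ) (s₁ s₂ δ : ℝ) (q : ℝ × ℝ) : ℝ :=
  X s₁ (label X s₁ s₂ q + δ) (clamp s₁ s₂ q.1) - q.2

variable (h : IsLipschitzFlow F K M s₁ s₂ X)
include h

theorem gap_pos {δ : ℝ} (hδ : 0 < δ) (q : ℝ × ℝ) : 0 < gap X s₁ s₂ δ q := by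
  have h1 := h.flow_lt h.left_mem (clamp_mem h.lt.le q.1)
    (show label X s₁ s₂ q < label X s₁ s₂ q + δ by linarith)
  rw [h.flow_label] at h1
  exact sub_pos.2 h1

theorem gap_le {δ : ℝ} (hδ : 0 < δ) (q : ℝ × ℝ) :
    gap X s₁ s₂ δ q ≤ Real.exp (K * (s₂ - s₁)) * δ := by
  have h1 := h.abs_sub_le h.left_mem (clamp_mem h.lt.le q.1)
    (label X s₁ s₂ q + δ) (label X s₁ s₂ q)
  rw [h.flow_label, add_sub_cancel_left, abs_of_pos hδ] at h1
  exact (le_abs_self _).trans h1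

theorem le_gap {δ : ℝ} (hδ : 0 < δ) (q : ℝ × ℝ) :
    δ ≤ Real.exp (K * (s₂ - s₁)) * gap X s₁ s₂ δ q := by
  have hq := clamp_mem h.lt.le q.1
  have h1 := h.abs_sub_le hq h.left_mem
    (X s₁ (label X s₁ s₂ q + δ) (clamp s₁ s₂ q.1)) q.2
  rw [h.flow_flow h.left_mem hq h.left_mem, h.init _ h.left_mem] at h1
  have e : label X s₁ s₂ q + δ - X (clamp s₁ s₂ q.1) q.2 s₁ = δ := by rw [label]; ring
  rw [e, abs_of_pos hδ] at h1
  refine h1.trans (le_of_eq ?_)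
  rw [← abs_of_pos (h.gap_pos hδ q)]
  rfl

theorem locallyLipschitz_gap (δ : ℝ) : LocallyLipschitz (gap X s₁ s₂ δ) :=
  (h.locallyLipschitz_flow.comp (locallyLipschitz_fst.prodMk
    (h.locallyLipschitz_label.add_real (LocallyLipschitz.const δ)))).sub_real locallyLipschitz_snd

/-- The difference quotient of `F` over the gap. -/
noncomputable def gapSlope (_ : IsLipschitzFlow F K M s₁ s₂ X) (δ : ℝ) (q : ℝ × ℝ) : ℝ :=
  (F (q.1, q.2 + gap X s₁ s₂ δ q) - F q) / gap X s₁ s₂ δ q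

theorem abs_gapSlope_le {δ : ℝ} (hδ : 0 < δ) (q : ℝ × ℝ) : |h.gapSlope δ q| ≤ K := by
  have hp := h.gap_pos hδ q
  rw [gapSlope, abs_div, abs_of_pos hp, div_le_iff₀ hp]
  have := h.abs_deriv_sub_le q.1 (q.2 + gap X s₁ s₂ δ q) q.2
  rwa [add_sub_cancel_left, abs_of_pos hp] at this

theorem measurable_gapSlope (δ : ℝ) : Measurable (h.gapSlope δ) := by
  have hg := (h.locallyLipschitz_gap δ).continuous
  have hF := h.lipschitz.continuous
  exact ((hF.comp (continuous_fst.prodMk (continuous_snd.add hg))).sub hF).measurable.div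
    hg.measurable

/-- The normalized inverse gap. -/
noncomputable def density (X : ℝ → ℝ → ℝ → ℝ) (s₁ s₂ δ : ℝ) (q : ℝ × ℝ) : ℝ :=
  δ * (gap X s₁ s₂ δ q)⁻¹

theorem locallyLipschitz_density {δ : ℝ} (hδ : 0 < δ) : LocallyLipschitz (density X s₁ s₂ δ) :=
  (LocallyLipschitz.const δ).mul_real
    ((h.locallyLipschitz_gap δ).inv_real fun q => (h.gap_pos hδ q).ne')

theorem density_le {δ : ℝ} (hδ : 0 < δ) (q : ℝ × ℝ) :
    density X s₁ s₂ δ q ≤ Real.exp (K * (s₂ - s₁)) := by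
  rw [density, ← div_eq_mul_inv, div_le_iff₀ (h.gap_pos hδ q)]
  exact h.le_gap hδ q

theorem le_density {δ : ℝ} (hδ : 0 < δ) (q : ℝ × ℝ) :
    (Real.exp (K * (s₂ - s₁)))⁻¹ ≤ density X s₁ s₂ δ q := by
  rw [density, ← div_eq_mul_inv, le_div_iff₀ (h.gap_pos hδ q),
    inv_mul_le_iff₀ (Real.exp_pos _)]
  exact h.gap_le hδ q

theorem density_pos {δ : ℝ} (hδ : 0 < δ) (q : ℝ × ℝ) : 0 < density X s₁ s₂ δ q :=
  mul_pos hδ (inv_pos.2 (h.gap_pos hδ q))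

/-- The gap is a difference of two solutions, so its logarithmic derivative along the flow is the
difference quotient of `F`. This is a discrete form of `∇^f r = -r ∂_t f` for the inverse Jacobian
`r`, with `r` Lipschitz for each `δ > 0`. -/
theorem fderiv_density {δ : ℝ} (hδ : 0 < δ) {q : ℝ × ℝ} (hq : q.1 ∈ Ioo s₁ s₂)
    (hd : DifferentiableAt ℝ (density X s₁ s₂ δ) q) :
    fderiv ℝ (density X s₁ s₂ δ) q (1, F q) = -(density X s₁ s₂ δ q * h.gapSlope δ q) := by
  have hq' := Ioo_subset_Icc_self hq
  set L := label X s₁ s₂ q with hL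
  have hgap : ∀ r ∈ Icc s₁ s₂,
      gap X s₁ s₂ δ (r, X q.1 q.2 r) = X s₁ (L + δ) r - X q.1 q.2 r := fun r hr => by
    rw [gap, h.label_comp hq' hr, clamp_of_mem hr]
  have e0 : X q.1 q.2 q.1 = q.2 := h.init _ hq' _
  have hgq : gap X s₁ s₂ δ q = X s₁ (L + δ) q.1 - q.2 := by
    rw [gap, clamp_of_mem hq']
  have e1 : F (q.1, X s₁ (L + δ) q.1) = F (q.1, q.2 + gap X s₁ s₂ δ q) := by
    rw [hgq]; congr 2; ring
  have hder : HasDerivAt (fun r => X s₁ (L + δ) r - X q.1 q.2 r)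
      (h.gapSlope δ q * gap X s₁ s₂ δ q) q.1 := by
    refine ((h.hasDerivAt s₁ h.left_mem (L + δ) q.1 hq).sub
      (h.hasDerivAt q.1 hq' q.2 q.1 hq)).congr_deriv ?_
    rw [e0, e1, gapSlope, div_mul_cancel₀ _ (h.gap_pos hδ q).ne']
  have hne : X s₁ (L + δ) q.1 - X q.1 q.2 q.1 ≠ 0 := by
    rw [e0, ← hgq]; exact (h.gap_pos hδ q).ne'
  have h2 := (hder.fun_inv hne).const_mul δ
  have h1 := h.hasDerivAt_comp hq hd
  have hev : (fun r => density X s₁ s₂ δ (r, X q.1 q.2 r)) =ᶠ[nhds q.1]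
      fun r => δ * (X s₁ (L + δ) r - X q.1 q.2 r)⁻¹ := by
    filter_upwards [Icc_mem_nhds hq.1 hq.2] with r hr
    rw [density, hgap r hr]
  rw [h1.unique (h2.congr_of_eventuallyEq hev), e0, ← hgq, density]
  have := (h.gap_pos hδ q).ne'
  field_simp

/-- The density factor cancels the zero-order term of the divergence, up to the error of a
difference quotient. -/
theorem graphDivergence_mul_density {f η : ℝ × ℝ → ℝ} {τ₀ ρ δ : ℝ} (hδ : 0 < δ)
    (hη0 : ∀ q ∉ strip X s₁ s₂ τ₀ ρ, η q = 0) (hFf : EqOn F f (strip X s₁ s₂ τ₀ ρ)) {q : ℝ × ℝ}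
    (hq₁ : q.1 ≠ s₁) (hq₂ : q.1 ≠ s₂) (hη : DifferentiableAt ℝ η q)
    (hd : DifferentiableAt ℝ (density X s₁ s₂ δ) q) :
    graphDivergence f (fun q => η q * density X s₁ s₂ δ q) q =
      density X s₁ s₂ δ q * fderiv ℝ η q (1, f q) +
        η q * density X s₁ s₂ δ q * (fderiv ℝ f q (0, 1) - h.gapSlope δ q) := by
  rw [graphDivergence, fderiv_fun_mul hη hd]
  simp only [add_apply, smul_apply, smul_eq_mul]
  by_cases hq : q ∈ strip X s₁ s₂ τ₀ ρ
  · have hq' : q.1 ∈ Ioo s₁ s₂ := ⟨lt_of_le_of_ne hq.1.1 hq₁.symm, lt_of_le_of_ne hq.1.2 hq₂⟩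
    have h1 := h.fderiv_density hδ hq' hd
    rw [hFf hq] at h1
    rw [h1]; ring
  · rw [hη0 q hq]; ring

open Filter Topology in
-- The gaps are positive and tend to `0`, so at a point of differentiability of `f` the quotients
-- converge to `∂_t f`.
theorem ae_tendsto_gapSlope {f : ℝ × ℝ → ℝ} (hf : LocallyLipschitz f) {U : Set (ℝ × ℝ)}
    (hU : IsOpen U) (hFf : EqOn F f U) {δ : ℕ → ℝ} (hδ : ∀ n, 0 < δ n)
    (hδ0 : Tendsto δ atTop (𝓝 0)) : ∀ᵐ q, q ∈ U →
      Tendsto (fun n => h.gapSlope (δ n) q) atTop (𝓝 (fderiv ℝ f q (0, 1))) := by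
  filter_upwards [hf.ae_differentiableAt] with q hq hqU
  have hg0 : Tendsto (fun n => gap X s₁ s₂ (δ n) q) atTop (𝓝 0) := by
    refine squeeze_zero (fun n => (h.gap_pos (hδ n) q).le) (fun n => h.gap_le (hδ n) q) ?_
    simpa using hδ0.const_mul (Real.exp (K * (s₂ - s₁)))
  have hg1 : Tendsto (fun n => gap X s₁ s₂ (δ n) q) atTop (𝓝[≠] 0) :=
    tendsto_nhdsWithin_iff.2 ⟨hg0, Eventually.of_forall fun n => (h.gap_pos (hδ n) q).ne'⟩
  have hd : HasDerivAt (fun x => f (q.1, x)) (fderiv ℝ f q (0, 1)) q.2 := by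
    have h1 : HasDerivAt (fun x : ℝ => (q.1, x)) (0, 1) q.2 :=
      (hasDerivAt_const q.2 q.1).prodMk (hasDerivAt_id q.2)
    exact HasFDerivAt.comp_hasDerivAt q.2 (f := fun x : ℝ => (q.1, x)) hq.hasFDerivAt h1
  have h2 := hd.tendsto_slope_zero.comp hg1
  refine h2.congr' ?_
  have hcont : Tendsto (fun n => (q.1, q.2 + gap X s₁ s₂ (δ n) q)) atTop (𝓝 q) := by
    have : Tendsto (fun n => q.2 + gap X s₁ s₂ (δ n) q) atTop (𝓝 q.2) := by
      simpa using hg0.const_add q.2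
    exact tendsto_const_nhds.prodMk_nhds this
  filter_upwards [hcont (hU.mem_nhds hqU)] with n hn
  simp only [Function.comp_apply, gapSlope, smul_eq_mul]
  rw [hFf hn, hFf hqU]
  ring

open Filter Topology in
/-- If `u` annihilates divergences and `u * ∇^f η` is nonnegative, then it vanishes. -/
theorem ae_mul_fderiv_eq_zero {f : ℝ × ℝ → ℝ} (hf : LocallyLipschitz f) {τ₀ ρ : ℝ}
    {U : Set (ℝ × ℝ)} (hU : IsOpen U) (hSU : strip X s₁ s₂ τ₀ ρ ⊆ U) (hFf : EqOn F f U)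
    {u : ℝ × ℝ → ℝ} (hu : Measurable u) {B : ℝ} (hB : ∀ q, |u q| ≤ B)
    (hweak : ∀ φ : ℝ × ℝ → ℝ, LocallyLipschitz φ → HasCompactSupport φ →
      (∀ q ∉ strip X s₁ s₂ τ₀ ρ, φ q = 0) → ∫ q, u q * graphDivergence f φ q = 0)
    {η : ℝ × ℝ → ℝ} (hη : LocallyLipschitz η) (hη0 : ∀ q ∉ strip X s₁ s₂ τ₀ ρ, η q = 0)
    (hnn : ∀ᵐ q, 0 ≤ u q * fderiv ℝ η q (1, f q)) :
    ∀ᵐ q, u q * fderiv ℝ η q (1, f q) = 0 := by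
  set S := strip X s₁ s₂ τ₀ ρ with hSdef
  have hS : IsCompact S := h.isCompact_strip τ₀ ρ
  have hB0 : 0 ≤ B := (abs_nonneg _).trans (hB 0)
  set E := Real.exp (K * (s₂ - s₁)) with hE
  have hE0 : 0 < E := Real.exp_pos _
  have htsupp : ∀ {ψ : ℝ × ℝ → ℝ}, (∀ q ∉ S, ψ q = 0) → tsupport ψ ⊆ S := fun hψ =>
    closure_minimal (fun q hq => by by_contra hqS; exact hq (hψ q hqS)) hS.isClosed
  have hcomp : ∀ {ψ : ℝ × ℝ → ℝ}, (∀ q ∉ S, ψ q = 0) → HasCompactSupport ψ := fun hψ =>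
    hS.of_isClosed_subset (isClosed_tsupport _) (htsupp hψ)
  have hDη0 : ∀ q ∉ S, fderiv ℝ η q = 0 := fun q hq =>
    fderiv_eq_zero_of_notMem_tsupport fun h => hq (htsupp hη0 h)
  obtain ⟨A, -, hA⟩ := hη.exists_norm_fderiv_le hS
  obtain ⟨A', hA'0, hA'⟩ := hf.exists_norm_fderiv_le hS
  obtain ⟨N, hN⟩ := hS.exists_bound_of_continuousOn hf.continuous.continuousOn
  obtain ⟨W, hW⟩ := hS.exists_bound_of_continuousOn hη.continuous.continuousOn
  set δ : ℕ → ℝ := fun n => 1 / ((n : ℝ) + 1) with hδdef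
  have hδ : ∀ n, 0 < δ n := fun n => by positivity
  have hδ0 : Tendsto δ atTop (𝓝 0) := tendsto_one_div_add_atTop_nhds_zero_nat
  set P : ℝ × ℝ → ℝ := fun q => u q * fderiv ℝ η q (1, f q) with hP
  have hPm : Measurable P := hu.mul (measurable_fderiv_graph η hf.continuous)
  have hP0 : ∀ q ∉ S, P q = 0 := fun q hq => by simp [hP, hDη0 q hq]
  have hPb : ∀ q ∈ S, |P q| ≤ B * (A * (1 + N)) := fun q hq => by
    rw [hP, abs_mul]
    exact mul_le_mul (hB q) (abs_fderiv_graph_le (hA q hq) (hN q hq)) (abs_nonneg _) hB0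
  have hPi : Integrable P := integrable_of_bounded_of_eq_zero hPm.aestronglyMeasurable hS hPb hP0
  set r : ℕ → ℝ × ℝ → ℝ := fun n => density X s₁ s₂ (δ n) with hr
  have hrL : ∀ n, LocallyLipschitz (r n) := fun n => h.locallyLipschitz_density (hδ n)
  have hrm : ∀ n, Measurable (r n) := fun n => (hrL n).continuous.measurable
  have hrp : ∀ n q, 0 < r n q := fun n q => h.density_pos (hδ n) q
  have hrE : ∀ n q, r n q ≤ E := fun n q => h.density_le (hδ n) q
  have hPri : ∀ n, Integrable fun q => r n q * P q := fun n =>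
    hPi.bdd_mul (c := E) (hrm n).aestronglyMeasurable (Eventually.of_forall fun q => by
      rw [Real.norm_of_nonneg (hrp n q).le]; exact hrE n q)
  set Q : ℕ → ℝ × ℝ → ℝ := fun n q =>
    u q * (η q * r n q * (fderiv ℝ f q (0, 1) - h.gapSlope (δ n) q)) with hQ
  have hQm : ∀ n, Measurable (Q n) := fun n => hu.mul ((hη.continuous.measurable.mul (hrm n)).mul
    ((measurable_fderiv_apply_const ℝ f _).sub (h.measurable_gapSlope _)))
  have hQ0 : ∀ n, ∀ q ∉ S, Q n q = 0 := fun n q hq => by simp [hQ, hη0 q hq]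
  have hQb : ∀ n, ∀ q ∈ S, |Q n q| ≤ B * (W * E * (A' + K)) := fun n q hq => by
    have hW0 : 0 ≤ W := (norm_nonneg _).trans (hW q hq)
    simp only [hQ, abs_mul, abs_of_pos (hrp n q)]
    refine mul_le_mul (hB q) (mul_le_mul (mul_le_mul (hW q hq) (hrE n q) (hrp n q).le hW0)
      ((abs_sub _ _).trans (add_le_add (abs_fderiv_snd_le (hA' q hq))
        (h.abs_gapSlope_le (hδ n) q))) (abs_nonneg _) (by positivity)) ?_ hB0
    exact mul_nonneg (mul_nonneg (abs_nonneg _) (hrp n q).le) (abs_nonneg _)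
  have hQi : ∀ n, Integrable (Q n) := fun n =>
    integrable_of_bounded_of_eq_zero (hQm n).aestronglyMeasurable hS (hQb n) (hQ0 n)
  have hsum : ∀ n, ∫ q, r n q * P q = -∫ q, Q n q := fun n => by
    have hφ0 : ∀ q ∉ S, η q * r n q = 0 := fun q hq => by rw [hη0 q hq, zero_mul]
    have h0 := hweak (fun q => η q * r n q) (hη.mul_real (hrL n)) (hcomp hφ0) hφ0
    have h1 : ∫ q, u q * graphDivergence f (fun q => η q * r n q) q =
        ∫ q, (r n q * P q + Q n q) := by
      apply integral_congr_ae
      filter_upwards [hη.ae_differentiableAt, (hrL n).ae_differentiableAt, ae_fst_ne s₁,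
        ae_fst_ne s₂] with q h1 h2 h3 h4
      rw [h.graphDivergence_mul_density (hδ n) hη0 (hFf.mono hSU) h3 h4 h1 h2]
      simp only [hP, hQ, hr]; ring
    rw [h1, integral_add (hPri n) (hQi n)] at h0
    linarith
  have hQlim : Tendsto (fun n => ∫ q, Q n q) atTop (𝓝 0) := by
    have := tendsto_integral_of_dominated_convergence (μ := (volume : Measure (ℝ × ℝ)))
      (F := Q) (f := fun _ => 0) (S.indicator fun _ => B * (W * E * (A' + K)))
      (fun n => (hQm n).aestronglyMeasurable)
      ((integrable_indicator_iff hS.measurableSet).2 (integrableOn_const hS.measure_lt_top.ne))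
      (fun n => Eventually.of_forall fun q => by
        by_cases hq : q ∈ S
        · rw [indicator_of_mem hq]; exact hQb n q hq
        · rw [indicator_of_notMem hq, hQ0 n q hq, norm_zero])
      (by
        filter_upwards [h.ae_tendsto_gapSlope hf hU hFf hδ hδ0] with q hq
        by_cases hqS : q ∈ S
        · have h1 : Tendsto (fun n => fderiv ℝ f q (0, 1) - h.gapSlope (δ n) q) atTop (𝓝 0) := by
            simpa using (hq (hSU hqS)).const_sub (fderiv ℝ f q (0, 1))
          have h2 : Tendsto (fun n => (u q * η q * r n q) *
              (fderiv ℝ f q (0, 1) - h.gapSlope (δ n) q)) atTop (𝓝 0) := by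
            refine bdd_le_mul_tendsto_zero' (|u q * η q| * E) (Eventually.of_forall fun n => ?_) h1
            rw [abs_mul, abs_of_pos (hrp n q)]
            exact mul_le_mul_of_nonneg_left (hrE n q) (abs_nonneg _)
          refine h2.congr fun n => ?_
          simp only [hQ]; ring
        · simp only [hQ0 _ q hqS]; exact tendsto_const_nhds)
    simpa using this
  -- The densities need not converge: a positive lower bound uniform in `n` suffices because `P` is
  -- nonnegative.
  have hle : ∀ n, E⁻¹ * ∫ q, P q ≤ -∫ q, Q n q := fun n => by
    rw [← hsum, ← integral_const_mul]
    refine integral_mono_ae (hPi.const_mul _) (hPri n) ?_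
    filter_upwards [hnn] with q hq
    exact mul_le_mul_of_nonneg_right (h.le_density (hδ n) q) hq
  have hle0 : E⁻¹ * ∫ q, P q ≤ 0 := by
    refine ge_of_tendsto' (by simpa using hQlim.neg) hle
  have hint0 : ∫ q, P q = 0 := by
    refine le_antisymm ?_ (integral_nonneg_of_ae hnn)
    by_contra hpos
    exact absurd hle0 (not_le.2 (mul_pos (inv_pos.2 hE0) (not_le.1 hpos)))
  exact (integral_eq_zero_iff_of_nonneg_ae hnn hPi).1 hint0

end IsLipschitzFlow

/-! ### Affinity of the field along flow lines -/

namespace IsLipschitzFlow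

variable {F : ℝ × ℝ → ℝ} {K M : NNReal} {s₁ s₂ : ℝ} {X : ℝ → ℝ → ℝ → ℝ}

/-- The mean acceleration over `[s₁, s₂]` of the solution with label `τ`. -/
noncomputable def meanSlope (F : ℝ × ℝ → ℝ) (X : ℝ → ℝ → ℝ → ℝ) (s₁ s₂ τ : ℝ) : ℝ :=
  (F (s₂, X s₁ τ s₂) - F (s₁, τ)) * (s₂ - s₁)⁻¹

/-- The deviation of `F` from its affine interpolation along solutions. -/
noncomputable def defect (F : ℝ × ℝ → ℝ) (X : ℝ → ℝ → ℝ → ℝ) (s₁ s₂ : ℝ) (q : ℝ × ℝ) : ℝ :=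
  F (clamp s₁ s₂ q.1, q.2) - F (s₁, label X s₁ s₂ q) -
    meanSlope F X s₁ s₂ (label X s₁ s₂ q) * (clamp s₁ s₂ q.1 - s₁)

/-- A cutoff in the label variable. -/
noncomputable def cutoff (τ₀ ρ x : ℝ) : ℝ := max 0 (ρ - |x - τ₀|)

theorem cutoff_nonneg (τ₀ ρ x : ℝ) : 0 ≤ cutoff τ₀ ρ x := le_max_left _ _

theorem locallyLipschitz_cutoff (τ₀ ρ : ℝ) : LocallyLipschitz (cutoff τ₀ ρ) := by
  have h1 : LipschitzWith 1 fun x : ℝ => |x - τ₀| := by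
    simpa [Real.dist_eq] using LipschitzWith.dist_left τ₀
  exact ((LocallyLipschitz.const ρ).sub_real h1.locallyLipschitz).const_max 0

variable (h : IsLipschitzFlow F K M s₁ s₂ X)
include h

theorem locallyLipschitz_meanSlope : LocallyLipschitz (meanSlope F X s₁ s₂) := by
  have h1 : LocallyLipschitz fun τ => X s₁ τ s₂ := by
    have := h.locallyLipschitz_flow.comp (LocallyLipschitz.prodMk_left (β := ℝ) s₂)
    simpa [Function.comp_def, clamp_of_mem h.right_mem] using this
  have hF := h.lipschitz.locallyLipschitz
  exact ((hF.comp ((LocallyLipschitz.const s₂).prodMk h1)).sub_real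
    (hF.comp (LocallyLipschitz.prodMk_left s₁))).mul_real (LocallyLipschitz.const _)

theorem locallyLipschitz_defect : LocallyLipschitz (defect F X s₁ s₂) := by
  have hF := h.lipschitz.locallyLipschitz
  have hc : LocallyLipschitz fun q : ℝ × ℝ => clamp s₁ s₂ q.1 :=
    lipschitzWith_clamp.locallyLipschitz.comp locallyLipschitz_fst
  have hL := h.locallyLipschitz_label
  exact ((hF.comp (hc.prodMk locallyLipschitz_snd)).sub_real
    (hF.comp ((LocallyLipschitz.const s₁).prodMk hL))).sub_real
    ((h.locallyLipschitz_meanSlope.comp hL).mul_real (hc.sub_real (LocallyLipschitz.const s₁)))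

/-- Interpolation is exact at both ends, and clamping extends this beyond them. Hence the defect
times a cutoff in the label is Lipschitz and vanishes off the strip. -/
theorem defect_eq_zero {q : ℝ × ℝ} (hq : q.1 ∉ Icc s₁ s₂) : defect F X s₁ s₂ q = 0 := by
  have hlt := h.lt
  have hfl := h.flow_label q
  rw [mem_Icc, not_and_or, not_le, not_le] at hq
  rcases hq with hq | hq
  · have hc : clamp s₁ s₂ q.1 = s₁ := by
      rw [clamp, min_eq_right (by linarith), max_eq_left hq.le]
    rw [hc, h.init _ h.left_mem] at hfl
    rw [defect, hc, hfl]; ring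
  · have hc : clamp s₁ s₂ q.1 = s₂ := by
      rw [clamp, min_eq_left hq.le, max_eq_right hlt.le]
    rw [hc] at hfl
    have : s₂ - s₁ ≠ 0 := by linarith
    rw [defect, hc, meanSlope, hfl, mul_assoc, inv_mul_cancel₀ this]; ring

theorem defect_comp {q : ℝ × ℝ} (hq : q.1 ∈ Icc s₁ s₂) {r : ℝ} (hr : r ∈ Icc s₁ s₂) :
    defect F X s₁ s₂ (r, X q.1 q.2 r) = F (r, X q.1 q.2 r) - F (s₁, label X s₁ s₂ q) -
      meanSlope F X s₁ s₂ (label X s₁ s₂ q) * (r - s₁) := by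
  rw [defect, h.label_comp hq hr, clamp_of_mem hr]

theorem hasDerivAt_defect {q : ℝ × ℝ} (hq : q.1 ∈ Ioo s₁ s₂) (hF : DifferentiableAt ℝ F q) :
    HasDerivAt (fun r => defect F X s₁ s₂ (r, X q.1 q.2 r))
      (fderiv ℝ F q (1, F q) - meanSlope F X s₁ s₂ (label X s₁ s₂ q)) q.1 := by
  have hq' := Ioo_subset_Icc_self hq
  have h1 := ((h.hasDerivAt_comp hq hF).sub_const (F (s₁, label X s₁ s₂ q))).sub
    (((hasDerivAt_id q.1).sub_const s₁).const_mul (meanSlope F X s₁ s₂ (label X s₁ s₂ q)))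
  rw [mul_one] at h1
  refine h1.congr_of_eventuallyEq ?_
  filter_upwards [Icc_mem_nhds hq.1 hq.2] with r hr
  exact h.defect_comp hq' hr

theorem eq_snd_flow {q : ℝ × ℝ} (hq : q.1 ∈ Icc s₁ s₂) : (q.1, X q.1 q.2 q.1) = q := by
  rw [h.init _ hq]

/-- If `u` is prescribed along solutions, so is its derivative in the direction `(1, F)`. -/
theorem fderiv_eq_of_hasDerivAt {u : ℝ × ℝ → ℝ} {q : ℝ × ℝ} (hq : q.1 ∈ Ioo s₁ s₂)
    (hu : DifferentiableAt ℝ u q) {γ : ℝ → ℝ} {d : ℝ}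
    (he : ∀ r ∈ Icc s₁ s₂, u (r, X q.1 q.2 r) = γ r) (hγ : HasDerivAt γ d q.1) :
    fderiv ℝ u q (1, F q) = d := by
  refine (h.hasDerivAt_comp hq hu).unique (hγ.congr_of_eventuallyEq ?_)
  filter_upwards [Icc_mem_nhds hq.1 hq.2] with r hr
  exact he r hr

/-- Two applications of `ae_mul_fderiv_eq_zero`. The first identifies `∇^f f` with the mean slope
wherever the cutoff is positive; the second deduces that the defect vanishes, with no need to
restrict an a.e. identity to single flow lines. -/
theorem defect_eq_zero_of_mem_strip {f : ℝ × ℝ → ℝ} (hf : LocallyLipschitz f)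
    (hstat : IsStationaryGraph f) {τ₀ ρ : ℝ} {U : Set (ℝ × ℝ)} (hU : IsOpen U)
    (hSU : strip X s₁ s₂ τ₀ ρ ⊆ U) (hFf : EqOn F f U) {q : ℝ × ℝ}
    (hq : |label X s₁ s₂ q - τ₀| < ρ) : defect F X s₁ s₂ q = 0 := by
  set S := strip X s₁ s₂ τ₀ ρ with hSdef
  set L := label X s₁ s₂ with hLdef
  set W := defect F X s₁ s₂ with hWdef
  set m := meanSlope F X s₁ s₂ with hmdef
  set β := cutoff τ₀ ρ with hβdef
  have hLL : LocallyLipschitz L := h.locallyLipschitz_label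
  have hWL : LocallyLipschitz W := h.locallyLipschitz_defect
  have hmL : LocallyLipschitz m := h.locallyLipschitz_meanSlope
  have hβL : LocallyLipschitz fun q => β (L q) := (locallyLipschitz_cutoff τ₀ ρ).comp hLL
  have hβ0 : ∀ q, 0 ≤ β (L q) := fun q => cutoff_nonneg _ _ _
  have hSc : IsClosed S := (h.isCompact_strip τ₀ ρ).isClosed
  have hηL : LocallyLipschitz fun q => β (L q) * W q := hβL.mul_real hWL
  have hη0 : ∀ q ∉ S, β (L q) * W q = 0 := fun q hq => by
    by_cases h1 : q.1 ∈ Icc s₁ s₂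
    · have h2 : ρ < |L q - τ₀| := not_le.1 fun h2 => hq ⟨h1, h2⟩
      have : β (L q) = 0 := max_eq_left (by linarith)
      rw [this, zero_mul]
    · rw [hWdef, h.defect_eq_zero h1, mul_zero]
  have hcompl : ∀ {ψ : ℝ × ℝ → ℝ}, (∀ q ∉ S, ψ q = 0) → ∀ q ∉ S, fderiv ℝ ψ q = 0 :=
    fun hψ q hq => by
      refine fderiv_eq_zero_of_notMem_tsupport fun h => hq ?_
      exact closure_minimal (fun q hq => by by_contra hqS; exact hq (hψ q hqS)) hSc h
  have hIoo : ∀ q ∈ S, q.1 ≠ s₁ → q.1 ≠ s₂ → q.1 ∈ Ioo s₁ s₂ := fun q hq h1 h2 =>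
    ⟨lt_of_le_of_ne hq.1.1 h1.symm, lt_of_le_of_ne hq.1.2 h2⟩
  have hFd : ∀ q ∈ S, DifferentiableAt ℝ f q → DifferentiableAt ℝ F q ∧
      fderiv ℝ F q (1, F q) = intrinsicGradient f q := fun q hq hd => by
    have hev : F =ᶠ[nhds q] f := Filter.eventuallyEq_of_mem (hU.mem_nhds (hSU hq)) hFf
    exact ⟨hev.differentiableAt_iff.2 hd, by
      rw [hev.fderiv_eq, hFf (hSU hq), intrinsicGradient_eq]⟩
  -- Being constant along flow lines, `ζ` satisfies the weak equation too and can be subtracted from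
  -- `tilt (∇^f f)`.
  set ζ : ℝ × ℝ → ℝ := fun q => tilt (m (L q)) with hζ
  have hζL : LocallyLipschitz ζ := contDiff_tilt.locallyLipschitz.comp (hmL.comp hLL)
  have hGm : Measurable fun q => tilt (intrinsicGradient f q) := by
    rw [funext (intrinsicGradient_eq f)]
    exact contDiff_tilt.continuous.measurable.comp (measurable_fderiv_graph f hf.continuous)
  have hDη : ∀ᵐ q, fderiv ℝ (fun q => β (L q) * W q) q (1, f q) =
      β (L q) * (S.indicator (fun q => intrinsicGradient f q - m (L q)) q) := by
    filter_upwards [hf.ae_differentiableAt, hηL.ae_differentiableAt, ae_fst_ne s₁,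
      ae_fst_ne s₂] with q h1 h2 h3 h4
    by_cases hq : q ∈ S
    · have hq' := hIoo q hq h3 h4
      obtain ⟨h5, h6⟩ := hFd q hq h1
      rw [indicator_of_mem hq, ← hFf (hSU hq), ← h6]
      exact h.fderiv_eq_of_hasDerivAt hq' h2 (fun r hr => by
        rw [hLdef, h.label_comp (Ioo_subset_Icc_self hq') hr])
        ((h.hasDerivAt_defect hq' h5).const_mul (β (L q)))
    · rw [indicator_of_notMem hq, hcompl hη0 q hq]; simp
  have step1 : ∀ᵐ q, q ∈ S → β (L q) * (intrinsicGradient f q - m (L q)) = 0 := by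
    have key := h.ae_mul_fderiv_eq_zero hf hU hSU hFf
      (u := fun q => tilt (intrinsicGradient f q) - ζ q) (B := 1 + 1)
      (hGm.sub hζL.continuous.measurable)
      (fun q => (abs_sub _ _).trans (add_le_add (abs_tilt_le_one _) (abs_tilt_le_one _)))
      (fun φ hφ hc hφ0 => by
        have i1 := integrable_mul_graphDivergence hf hφ hc hGm
          fun _ _ => ⟨1, fun q _ => abs_tilt_le_one _⟩
        have i2 := integrable_mul_graphDivergence hf hφ hc hζL.continuous.measurable
          fun _ _ => ⟨1, fun q _ => abs_tilt_le_one _⟩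
        simp only [sub_mul]
        rw [integral_sub i1 i2, hstat.integral_eq_zero hf hφ hc,
          integral_mul_graphDivergence hf hζL hφ hc]
        have : ∫ q, φ q * fderiv ℝ ζ q (1, f q) = 0 := by
          refine integral_eq_zero_of_ae ?_
          filter_upwards [hζL.ae_differentiableAt, ae_fst_ne s₁, ae_fst_ne s₂] with q h1 h2 h3
          by_cases hq : q ∈ S
          · have hq' := hIoo q hq h2 h3
            rw [← hFf (hSU hq), h.fderiv_eq_of_hasDerivAt hq' h1 (γ := fun _ => ζ q) (fun r hr => by
              simp only [hζ, hLdef]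
              rw [h.label_comp (Ioo_subset_Icc_self hq') hr]) (hasDerivAt_const _ _)]
            simp
          · simp [hφ0 q hq]
        rw [this]; simp)
      hηL hη0
      (by
        filter_upwards [hDη] with q hq
        rw [hq]
        by_cases hqS : q ∈ S
        · rw [indicator_of_mem hqS]
          have : 0 ≤ (tilt (intrinsicGradient f q) - tilt (m (L q))) *
              (intrinsicGradient f q - m (L q)) := by
            rcases le_total (intrinsicGradient f q) (m (L q)) with hle | hle
            · exact mul_nonneg_of_nonpos_of_nonpos
                (sub_nonpos.2 (strictMono_tilt.monotone hle)) (sub_nonpos.2 hle)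
            · exact mul_nonneg (sub_nonneg.2 (strictMono_tilt.monotone hle)) (sub_nonneg.2 hle)
          have := mul_nonneg (hβ0 q) this
          simp only [hζ]; linarith
        · rw [indicator_of_notMem hqS]; simp)
    filter_upwards [key, hDη] with q h1 h2 hqS
    rw [h2, indicator_of_mem hqS] at h1
    rcases mul_eq_zero.1 h1 with h3 | h3
    · rw [strictMono_tilt.injective (sub_eq_zero.1 h3), sub_self, mul_zero]
    · exact h3
  -- The weight `q.1 - s₂` has derivative `1` along the flow, and the derivative of `W` contributes
  -- nothing by `step1`; what remains is `β W²`, which is nonnegative.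
  have hη2L : LocallyLipschitz fun q : ℝ × ℝ => (q.1 - s₂) * (β (L q) * W q * W q) :=
    (locallyLipschitz_fst.sub_real (LocallyLipschitz.const s₂)).mul_real (hηL.mul_real hWL)
  have hη20 : ∀ q ∉ S, (q.1 - s₂) * (β (L q) * W q * W q) = 0 := fun q hq => by
    rw [hη0 q hq]; ring
  have hDη2 : ∀ᵐ q : ℝ × ℝ, fderiv ℝ (fun q : ℝ × ℝ => (q.1 - s₂) * (β (L q) * W q * W q)) q
      (1, f q) = β (L q) * W q * W q := by
    filter_upwards [hf.ae_differentiableAt, hη2L.ae_differentiableAt, ae_fst_ne s₁,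
      ae_fst_ne s₂, step1] with q h1 h2 h3 h4 h7
    by_cases hq : q ∈ S
    · have hq' := hIoo q hq h3 h4
      obtain ⟨h5, h6⟩ := hFd q hq h1
      have hd := h.hasDerivAt_defect hq' h5
      have e : (fun r => W (r, X q.1 q.2 r)) q.1 = W q := by
        simp only [h.eq_snd_flow (Ioo_subset_Icc_self hq')]
      have hder := ((hasDerivAt_id q.1).sub_const s₂).mul ((hd.const_mul (β (L q))).mul hd)
      rw [← hFf (hSU hq)]
      rw [h.fderiv_eq_of_hasDerivAt hq' h2 (fun r hr => by
        rw [hLdef, h.label_comp (Ioo_subset_Icc_self hq') hr]; rfl) hder, h6]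
      simp only [Pi.mul_apply, id, h.eq_snd_flow (Ioo_subset_Icc_self hq')]
      have h8 := h7 hq
      linear_combination (2 * (q.1 - s₂) * W q) * h8
    · rw [hcompl hη20 q hq, hη0 q hq]; simp
  have step2 : ∀ᵐ q, β (L q) * W q * W q = 0 := by
    have key := h.ae_mul_fderiv_eq_zero hf hU hSU hFf (u := fun _ => 1) (B := 1)
      measurable_const (fun q => by simp)
      (fun φ hφ hc _ => by
        rw [integral_mul_graphDivergence hf (LocallyLipschitz.const 1) hφ hc]
        simp)
      hη2L hη20
      (by
        filter_upwards [hDη2] with q hq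
        rw [hq, one_mul, mul_assoc]
        exact mul_nonneg (hβ0 q) (mul_self_nonneg _))
    filter_upwards [key, hDη2] with q h1 h2
    rw [← h2, ← h1, one_mul]
  -- Continuity upgrades the a.e. identity to every point, in particular to points of any single
  -- flow line.
  have hall : (fun q => β (L q) * W q * W q) = fun _ => 0 :=
    ((hηL.mul_real hWL).continuous.ae_eq_iff_eq volume continuous_const).1 step2
  have hq0 := congrFun hall q
  have hβpos : 0 < β (L q) := lt_max_of_lt_right (by linarith)
  simp only [mul_eq_zero, hβpos.ne', false_or, or_self] at hq0
  exact hq0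

end IsLipschitzFlow

/-! ### Stationary graphs have parabolic characteristics -/

open IsLipschitzFlow in
theorem IsStationaryGraph.hasParabolicCharacteristics {f : ℝ × ℝ → ℝ} (hf : LocallyLipschitz f)
    (hstat : IsStationaryGraph f) : HasParabolicCharacteristics f := by
  intro p
  obtain ⟨F, K, M', hF, hM', hFf⟩ := hf.exists_lipschitzWith_eqOn_closedBall p zero_le_one
  set M := M'.toNNReal with hM
  have hFM : ∀ q, |F q| ≤ M := fun q => (hM' q).trans (Real.le_coe_toNNReal _)
  have hM0 : (0 : ℝ) ≤ M := M.2
  -- This makes `M (s₂ - s₁) = 2 M ε ≤ 1 / 4`. Points of the strip of label radius `1 / 4` are then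
  -- within `1 / 2` of `τ₀` vertically, and `τ₀` within `1 / 4` of `p.2`, so the strip lies in the
  -- unit ball, where `F = f`.
  set ε : ℝ := 1 / (8 * (M + 1)) with hε
  have hε1 : ε * (8 * (M + 1)) = 1 := by rw [hε]; field_simp
  have hε0 : 0 < ε := by positivity
  have hMε : 0 ≤ ε * M := mul_nonneg hε0.le hM0
  obtain ⟨X, h⟩ := hF.exists_isLipschitzFlow hFM (show p.1 - ε < p.1 + ε by linarith)
  set s₁ := p.1 - ε with hs₁
  set s₂ := p.1 + ε with hs₂
  have hp : p.1 ∈ Icc s₁ s₂ := ⟨by linarith, by linarith⟩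
  set τ₀ := label X s₁ s₂ p with hτ₀
  have hτp : |τ₀ - p.2| ≤ 1 / 4 := (h.abs_label_sub_le hp).trans (by
    rw [hs₁, hs₂]; nlinarith)
  have hSU : strip X s₁ s₂ τ₀ (1 / 4) ⊆ Metric.ball p 1 := fun q hq => by
    have h1 := h.abs_snd_sub_le_of_mem_strip hq
    have h2 : 1 / 4 + M * (s₂ - s₁) ≤ 1 / 2 := by rw [hs₁, hs₂]; nlinarith
    have h3 := hq.1
    rw [Metric.mem_ball, Prod.dist_eq, Real.dist_eq, Real.dist_eq]
    refine max_lt ?_ ?_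
    · rw [abs_lt]; constructor <;> nlinarith [h3.1, h3.2]
    · have h4 := abs_le.1 (h1.trans h2)
      have h5 := abs_le.1 hτp
      rw [abs_lt]; constructor <;> linarith [h4.1, h4.2, h5.1, h5.2]
  set γ := X p.1 p.2 with hγ
  have hFf' : EqOn F f (Metric.ball p 1) := hFf.mono Metric.ball_subset_closedBall
  have hlab : ∀ r ∈ Icc s₁ s₂, label X s₁ s₂ (r, γ r) = τ₀ := fun r hr => h.label_comp hp hr
  set c := meanSlope F X s₁ s₂ τ₀ with hc
  have haff : ∀ r ∈ Icc s₁ s₂, F (r, γ r) = F (s₁, τ₀) + c * (r - s₁) := fun r hr => by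
    have h1 := h.defect_eq_zero_of_mem_strip hf hstat Metric.isOpen_ball hSU hFf'
      (q := (r, γ r)) (by rw [hlab r hr]; norm_num)
    rw [h.defect_comp hp hr] at h1
    linarith
  have hfp : f p = F (s₁, τ₀) + c * (p.1 - s₁) := by
    rw [← haff _ hp, hγ, h.eq_snd_flow hp]
    exact (hFf (Metric.mem_closedBall_self zero_le_one)).symm
  have haff' : ∀ r ∈ Icc s₁ s₂, F (r, γ r) = f p + c * (r - p.1) := fun r hr => by
    rw [haff r hr, hfp]; ring
  -- Both curves solve `x' = f p + c (s - p.1)`, whose right side depends on time alone, and both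
  -- pass through `p`.
  have hpar : EqOn γ (parabola p (f p) c) (Icc s₁ s₂) := by
    have hv : LocallyLipschitz fun q : ℝ × ℝ => f p + c * (q.1 - p.1) :=
      ContDiff.locallyLipschitz (𝕂 := ℝ) (by fun_prop)
    refine hv.eqOn_of_hasDerivAt (h.continuousOn _ hp _) (continuous_parabola _ _ _).continuousOn
      (fun s hs => ?_) (fun s _ => hasDerivAt_parabola _ _ _ _) hp ?_
    · have := h.hasDerivAt _ hp p.2 s hs
      rwa [haff' s (Ioo_subset_Icc_self hs)] at this
    · rw [parabola_self]; exact h.init _ hp _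
  refine ⟨c, ε, hε0, fun s hs => ?_⟩
  rw [abs_lt] at hs
  have hs' : s ∈ Icc s₁ s₂ := ⟨by linarith [hs.1], by linarith [hs.2]⟩
  rw [← hpar hs', ← haff' s hs']
  refine (hFf' (hSU ⟨hs', ?_⟩)).symm
  rw [hlab s hs']; norm_num

theorem mainTheorem4 (f : ℝ × ℝ → ℝ) (hf : LocallyLipschitz f) (hstat : IsStationaryGraph f) :
    ∃ Ψ : ℝ × ℝ → ℝ × ℝ,
      (IsLagrangianHomeomorphism f Set.univ Set.univ Ψ ∧
        IsLocallyBiLipschitz Set.univ Set.univ Ψ ∧ ∀ τ : ℝ, (Ψ (0, τ)).2 = τ) ∧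
      (∀ Ψ' : ℝ × ℝ → ℝ × ℝ,
        (IsLagrangianHomeomorphism f Set.univ Set.univ Ψ' ∧
          IsLocallyBiLipschitz Set.univ Set.univ Ψ' ∧ ∀ τ : ℝ, (Ψ' (0, τ)).2 = τ) →
        Ψ' = Ψ) ∧
      -- `g` is the locally Lipschitz representative of the a.e. defined function `∇^f f`
      ∃ g : ℝ × ℝ → ℝ, LocallyLipschitz g ∧ g =ᵐ[MeasureTheory.volume] intrinsicGradient f ∧
        ∃ a b : ℝ → ℝ, LocallyLipschitz a ∧ LocallyLipschitz b ∧
          (∀ τ : ℝ, a τ = g (0, τ)) ∧ (∀ τ : ℝ, b τ = f (0, τ)) ∧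
          ∀ s τ : ℝ, Ψ (s, τ) = (s, a τ * (s ^ 2 / 2) + b τ * s + τ) := by
  exact (hstat.hasParabolicCharacteristics hf).exists_lagrangianHomeomorphism hf
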